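/- Let $d$ be a positive integer and let $s\in\{1,2,\dots\}\cup\{\infty\}$. Let $W^s_2(\mathbb R^d)$ be the Hilbert space of complex-valued functions $f\in L_2(\mathbb R^d)$ all of whose weak partial derivatives $D^\alpha f$ with $|\alpha|_1=\alpha_1+\dots+\alpha_d\le s$ (all $\alpha\in\mathbb N_0^d$ if $s=\infty$) belong to $L_2(\mathbb R^d)$ and satisfy $$\|f\|_{W^s_2(\mathbb R^d)}^2=\sum_{|\alpha|_1\le s}\|D^\alpha f\|_{L_2(\mathbb R^d)}^2<\infty ,$$ with the inner product $\langle f,g\rangle=\sum_{|\alpha|_1\le s}\langle D^\alpha f,D^\alpha g\rangle_{L_2(\mathbb R^d)}$. Let $I_{d,s}f=f$ denote the embedding of $W^s_2(\mathbb R^d)$ into $L_\infty(\mathbb R^d)$, and $\|I_{d,s}\|$ its operator norm. Theorem. Let $d,s$ be positive integers with $s>d/2$. Then $I_{d,\infty}$ and $I_{d,s}$ are well-defined bounded linear operators, and $$\left(\frac5{11}\right)^d\le\left(\frac2{3\pi}\right)^{d/2}=\|I_{d,\infty}\|\le\|I_{d,s}\|\le\min\left\{\frac{d+1}{2^{(d+1)/2}\pi^{d/4}},\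 10.03\left(\frac6{11}\right)^d\right\}.$$ In particular, the best embedding constant is exponentially small in $d$. Moreover, $$\frac{d+1}{2^{(d+1)/2}\pi^{d/4}}\le 10.04\left(\frac6{11}\right)^d\quad\text{for all } d\ge1,$$ and $10.04$ may be replaced by $10.03$ here for all $d\notin\{36,37\}$. -/

import Mathlib

open MeasureTheory
open scoped ENNReal ContDiff

/-- The first order partial derivative of `φ : ℝ^d → ℂ` in the direction of the `j`-th axis. -/
noncomputable def partialDeriv {d : ℕ} (j : Fin d) (φ : EuclideanSpace ℝ (Fin d) → ℂ) :
    EuclideanSpace ℝ (Fin d) → ℂ :=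
  fun x => fderiv ℝ φ x (EuclideanSpace.single j 1)

/-- The classical partial derivative `D^α φ = ∂_1^{α_1} ⋯ ∂_d^{α_d} φ`. -/
noncomputable def multiDeriv {d : ℕ} (α : Fin d → ℕ) (φ : EuclideanSpace ℝ (Fin d) → ℂ) :
    EuclideanSpace ℝ (Fin d) → ℂ :=
  (List.finRange d).foldr (fun j ψ => (partialDeriv j)^[α j] ψ) φ

/-- The complex Hilbert space `L_2(ℝ^d)` with respect to Lebesgue measure. -/
abbrev L2Space (d : ℕ) : Type :=
  Lp (α := EuclideanSpace ℝ (Fin d)) ℂ 2 volume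

/-- The complex Banach space `L_∞(ℝ^d)`, normed by the essential supremum. -/
abbrev LinftySpace (d : ℕ) : Type :=
  Lp (α := EuclideanSpace ℝ (Fin d)) ℂ ∞ volume

/-- `g` is the weak derivative `D^α f`:
`∫ f D^α φ = (-1)^{|α|} ∫ g φ` for every smooth compactly supported `φ`. -/
def IsWeakDeriv {d : ℕ} (α : Fin d → ℕ) (f g : L2Space d) : Prop :=
  ∀ φ : EuclideanSpace ℝ (Fin d) → ℂ, ContDiff ℝ ∞ φ → HasCompactSupport φ →
    ∫ x, f x * multiDeriv α φ x = (-1) ^ (∑ j, α j) * ∫ x, g x * φ x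

/-- Multi-indices `α ∈ ℕ^d` with `|α|_1 ≤ s`; all multi-indices if `s = ∞`. -/
abbrev MultiIndex (d : ℕ) (s : ℕ∞) : Type :=
  {α : Fin d → ℕ // ((∑ j, α j : ℕ) : ℕ∞) ≤ s}

/-- The multi-index `0`. -/
def MultiIndex.zero (d : ℕ) (s : ℕ∞) : MultiIndex d s := ⟨0, by simp⟩

/-- The Hilbert sum of copies of `L_2(ℝ^d)` over all multi-indices with `|α|_1 ≤ s`. -/
abbrev L2Families (d : ℕ) (s : ℕ∞) : Type :=
  lp (fun _ : MultiIndex d s => L2Space d) 2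

theorem partialDeriv_smooth {d : ℕ} (j : Fin d) {φ : EuclideanSpace ℝ (Fin d) → ℂ}
    (h : ContDiff ℝ ∞ φ ∧ HasCompactSupport φ) :
    ContDiff ℝ ∞ (partialDeriv j φ) ∧ HasCompactSupport (partialDeriv j φ) :=
  ⟨(h.1.fderiv_right (m := ∞) (by simp)).clm_apply contDiff_const,
    h.2.fderiv_apply (𝕜 := ℝ) _⟩

theorem multiDeriv_smooth {d : ℕ} (α : Fin d → ℕ) {φ : EuclideanSpace ℝ (Fin d) → ℂ}
    (h : ContDiff ℝ ∞ φ ∧ HasCompactSupport φ) :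
    ContDiff ℝ ∞ (multiDeriv α φ) ∧ HasCompactSupport (multiDeriv α φ) := by
  unfold multiDeriv
  induction List.finRange d with
  | nil => exact h
  | cons j l ih =>
    rw [List.foldr_cons]
    generalize α j = n
    induction n with
    | zero => exact ih
    | succ n ihn => rw [Function.iterate_succ_apply']; exact partialDeriv_smooth j ihn

theorem multiDeriv_zero {d : ℕ} (φ : EuclideanSpace ℝ (Fin d) → ℂ) :
    multiDeriv 0 φ = φ := by
  unfold multiDeriv
  induction List.finRange d with
  | nil => rfl
  | cons j l ih => rw [List.foldr_cons, ih]; rfl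

theorem L2Space.integrable_mul {d : ℕ} (f : L2Space d) {φ : EuclideanSpace ℝ (Fin d) → ℂ}
    (h : ContDiff ℝ ∞ φ ∧ HasCompactSupport φ) : Integrable (fun x => f x * φ x) :=
  MemLp.integrable_mul (p := 2) (q := 2) (Lp.memLp f)
    (h.1.continuous.memLp_of_hasCompactSupport h.2)

theorem IsWeakDeriv.add {d : ℕ} {α : Fin d → ℕ} {f g f' g' : L2Space d}
    (h : IsWeakDeriv α f g) (h' : IsWeakDeriv α f' g') :
    IsWeakDeriv α (f + f') (g + g') := by
  intro φ h1 h2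
  have hD := multiDeriv_smooth α ⟨h1, h2⟩
  have e1 : ∫ x, (f + f') x * multiDeriv α φ x =
      ∫ x, (f x * multiDeriv α φ x + f' x * multiDeriv α φ x) := by
    refine integral_congr_ae ?_
    filter_upwards [Lp.coeFn_add f f'] with x hx
    rw [hx, Pi.add_apply, add_mul]
  have e2 : ∫ x, (g + g') x * φ x = ∫ x, (g x * φ x + g' x * φ x) := by
    refine integral_congr_ae ?_
    filter_upwards [Lp.coeFn_add g g'] with x hx
    rw [hx, Pi.add_apply, add_mul]
  rw [e1, e2, integral_add (f.integrable_mul hD) (f'.integrable_mul hD),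
    integral_add (g.integrable_mul ⟨h1, h2⟩) (g'.integrable_mul ⟨h1, h2⟩),
    h φ h1 h2, h' φ h1 h2, mul_add]

theorem IsWeakDeriv.smul {d : ℕ} {α : Fin d → ℕ} {f g : L2Space d} (c : ℂ)
    (h : IsWeakDeriv α f g) : IsWeakDeriv α (c • f) (c • g) := by
  intro φ h1 h2
  have e1 : ∫ x, (c • f) x * multiDeriv α φ x = ∫ x, c * (f x * multiDeriv α φ x) := by
    refine integral_congr_ae ?_
    filter_upwards [Lp.coeFn_smul c f] with x hx
    rw [hx, Pi.smul_apply, smul_eq_mul, mul_assoc]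
  have e2 : ∫ x, (c • g) x * φ x = ∫ x, c * (g x * φ x) := by
    refine integral_congr_ae ?_
    filter_upwards [Lp.coeFn_smul c g] with x hx
    rw [hx, Pi.smul_apply, smul_eq_mul, mul_assoc]
  rw [e1, e2, integral_const_mul, integral_const_mul, h φ h1 h2, mul_left_comm]

/-- Weak derivatives in `L_2(ℝ^d)` are unique. -/
theorem IsWeakDeriv.unique {d : ℕ} {α : Fin d → ℕ} {f g g' : L2Space d}
    (h : IsWeakDeriv α f g) (h' : IsWeakDeriv α f g') : g = g' := by
  apply Lp.ext
  refine ae_eq_of_integral_contDiff_smul_eq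
    ((Lp.memLp g).locallyIntegrable (by norm_num))
    ((Lp.memLp g').locallyIntegrable (by norm_num)) ?_
  intro φ h1 h2
  have k1 : ContDiff ℝ ∞ (fun x => (φ x : ℂ)) := Complex.ofRealCLM.contDiff.comp h1
  have k2 : HasCompactSupport (fun x => (φ x : ℂ)) :=
    h2.comp_left (g := fun r : ℝ => (r : ℂ)) Complex.ofReal_zero
  have key := (h _ k1 k2).symm.trans (h' _ k1 k2)
  have key' := mul_left_cancel₀ (pow_ne_zero _ (by norm_num)) key
  simpa only [Complex.real_smul, mul_comm] using key'

theorem IsWeakDeriv.self {d : ℕ} (f : L2Space d) : IsWeakDeriv 0 f f := by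
  intro φ _ _
  simp [multiDeriv_zero]

/-- The Sobolev space `W^s_2(ℝ^d)`, `s ∈ ℕ ∪ {∞}`. A function `f ∈ L_2(ℝ^d)` with weak derivatives
`D^α f ∈ L_2(ℝ^d)` for all `|α|_1 ≤ s` and `∑_{|α|_1 ≤ s} ‖D^α f‖² < ∞` is represented by the
family `F = (D^α f)_{|α|_1 ≤ s}`, whose member at `α = 0` is `f` itself. The norm inherited from
the Hilbert sum satisfies `‖F‖² = ∑_{|α|_1 ≤ s} ‖D^α f‖²`. -/
noncomputable def SobolevSpace (d : ℕ) (s : ℕ∞) : Submodule ℂ (L2Families d s) where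
  carrier := {F | ∀ α : MultiIndex d s, IsWeakDeriv α.1 (F (MultiIndex.zero d s)) (F α)}
  add_mem' := fun {F G} hF hG α => (hF α).add (hG α)
  zero_mem' := by
    intro α
    have h := (IsWeakDeriv.self (0 : L2Space d))
    intro φ h1 h2
    have e : ∀ ψ : EuclideanSpace ℝ (Fin d) → ℂ, ∫ x, (0 : L2Space d) x * ψ x = 0 := by
      intro ψ
      refine (integral_congr_ae ?_).trans (integral_zero _ ℂ)
      filter_upwards [Lp.coeFn_zero ℂ (2 : ℝ≥0∞)
        (volume : Measure (EuclideanSpace ℝ (Fin d)))] with x hx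
      rw [hx, Pi.zero_apply, zero_mul]
    change ∫ x, (0 : L2Space d) x * _ = _ * ∫ x, (0 : L2Space d) x * _
    rw [e, e, mul_zero]
  smul_mem' := fun c _ hF α => (hF α).smul c

/-- The underlying `L_2` function of an element of the Sobolev space. -/
noncomputable def SobolevSpace.toL2 {d : ℕ} {s : ℕ∞} (F : SobolevSpace d s) : L2Space d :=
  F.1 (MultiIndex.zero d s)

/-- An element of the Sobolev space is determined by its underlying function. -/
theorem SobolevSpace.toL2_injective (d : ℕ) (s : ℕ∞) :
    Function.Injective (SobolevSpace.toL2 : SobolevSpace d s → L2Space d) := by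
  intro F G h
  apply Subtype.ext
  apply lp.ext
  funext α
  have hF := F.2 α
  have hG := G.2 α
  change F.1 (MultiIndex.zero d s) = G.1 (MultiIndex.zero d s) at h
  rw [← h] at hG
  exact hF.unique hG

/-- For finite `s`, the functions in the Sobolev space are exactly those `f ∈ L_2(ℝ^d)` that have
all weak derivatives of order at most `s` in `L_2(ℝ^d)`. -/
theorem SobolevSpace.exists_toL2_eq_iff (d s : ℕ) (f : L2Space d) :
    (∃ F : SobolevSpace d s, SobolevSpace.toL2 F = f) ↔
      ∀ α : Fin d → ℕ, ∑ j, α j ≤ s → ∃ g : L2Space d, IsWeakDeriv α f g := by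
  constructor
  · rintro ⟨F, rfl⟩ α hα
    exact ⟨_, F.2 ⟨α, by exact_mod_cast hα⟩⟩
  · intro h
    have hfin : Finite (MultiIndex d s) := by
      refine Set.Finite.subset (Set.finite_Iic (fun _ : Fin d => s)) ?_
      intro α hα j
      have hα' : ∑ j, α j ≤ s :=
        WithTop.coe_le_coe.mp (show ((∑ j, α j : ℕ) : ℕ∞) ≤ (s : ℕ∞) from hα)
      exact (Finset.single_le_sum (fun i _ => Nat.zero_le (α i)) (Finset.mem_univ j)).trans hα'
    choose g hg using fun α : MultiIndex d s => h α.1 (by exact_mod_cast α.2)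
    have h0 : g (MultiIndex.zero d s) = f := (hg (MultiIndex.zero d s)).unique (IsWeakDeriv.self f)
    refine ⟨⟨⟨g, memℓp_gen (Summable.of_finite)⟩, ?_⟩, h0⟩
    intro α
    change IsWeakDeriv α.1 (g (MultiIndex.zero d s)) (g α)
    rw [h0]
    exact hg α

/-- The inherited inner product; Mathlib's `inner` is conjugate linear in its first argument. -/
theorem SobolevSpace.inner_eq {d : ℕ} {s : ℕ∞} (F G : SobolevSpace d s) :
    inner ℂ F G = ∑' α : MultiIndex d s, inner ℂ (F.1 α) (G.1 α) :=
  lp.inner_eq_tsum F.1 G.1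

/-- The inherited norm. -/
theorem SobolevSpace.norm_sq_eq {d : ℕ} {s : ℕ∞} (F : SobolevSpace d s) :
    ‖F‖ ^ 2 = ∑' α : MultiIndex d s, ‖F.1 α‖ ^ 2 := by
  have h := lp.norm_rpow_eq_tsum (p := 2) (by norm_num) F.1
  simpa using h

/-- `I` is the embedding of `W^s_2(ℝ^d)` into `L_∞(ℝ^d)`: it maps each function to itself. -/
def IsLinftyEmbedding {d : ℕ} {s : ℕ∞} (I : SobolevSpace d s →L[ℂ] LinftySpace d) : Prop :=
  ∀ F : SobolevSpace d s, (I F : EuclideanSpace ℝ (Fin d) → ℂ) =ᵐ[volume] SobolevSpace.toL2 F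

/-- There is at most one embedding. -/
theorem IsLinftyEmbedding.unique {d : ℕ} {s : ℕ∞} {I J : SobolevSpace d s →L[ℂ] LinftySpace d}
    (hI : IsLinftyEmbedding I) (hJ : IsLinftyEmbedding J) : I = J := by
  apply ContinuousLinearMap.ext
  intro F
  exact Lp.ext ((hI F).trans (hJ F).symm)

/-! Everything reduces to one integral. On the Fourier side `D^α` is multiplication by `∏ (2πi
ξ_j)^α_j`, so by Plancherel the Sobolev norm is the weighted `L²` norm of `𝓕 f` with weight `v = ∑
|(2πξ)^α|²` (`SobolevSpace.enorm_sq`). Cauchy–Schwarz gives `‖f‖_∞ ≤ ‖𝓕 f‖_1 ≤ ‖f‖ (∫ 1/v)^{1/2}`,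
and the function with Fourier transform `1/v` attains equality at the origin. Hence `‖I‖² = ∫ 1/v`
(`IsLinftyEmbedding.norm_eq`).

For `s = ∞` the weight is a product of geometric series, so `1/v = ∏ max(0, 1 - (2πξ_j)²)`, and the
integral factorizes into `(2/(3π))^d`.

For finite `s > d/2`, two homogeneous degrees `k < l` around `d/2` are kept in `v`. Since
multinomial coefficients of degree `k` are at most `k!`, each degree contributes at least
`|2πξ|^{2k}/k!` (`ofReal_le_sobolevWeight`). In polar coordinates the resulting radial integral is
an arctangent, for `k, l = d/2 ∓ 1` when `d` is even and `(d ∓ 1)/2` when `d` is odd. With `q =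
1/(2√π)` this yields `‖I‖² ≤ (π/2)(d+1) q^d` and `‖I‖² ≤ (d+1)² q^d / 2`. The second bound is the
closed form in the theorem. The comparison with `(6/11)^d` is elementary; only `d = 36, 37` need the
first bound to reach `10.03`. -/

open SchwartzMap FourierTransform LineDeriv

/-! ### Weak derivatives on the Fourier side -/

/-- The symbol `∏ j, (2πi ξ_j) ^ α_j` of the derivative `D^α`. -/
noncomputable def derivSymbol {d : ℕ} (α : Fin d → ℕ) (ξ : EuclideanSpace ℝ (Fin d)) : ℂ :=
  ∏ j, (2 * Real.pi * Complex.I * ξ j) ^ α j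

theorem continuous_derivSymbol {d : ℕ} (α : Fin d → ℕ) : Continuous (derivSymbol α) := by
  unfold derivSymbol
  fun_prop

theorem L2Space.integral_fourier_mul {d : ℕ} (f : L2Space d)
    (φ : 𝓢(EuclideanSpace ℝ (Fin d), ℂ)) :
    ∫ x, (𝓕 f : L2Space d) x * φ x = ∫ x, f x * (𝓕 φ) x := by
  have h := congrArg (fun T => T φ) (Lp.fourier_toTemperedDistribution_eq f)
  simp only [TemperedDistribution.fourier_apply, Lp.toTemperedDistribution_apply, smul_eq_mul] at h
  simpa only [mul_comm] using h.symm

theorem L2Space.integrable_mul_schwartz {d : ℕ} (f : L2Space d)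
    (φ : 𝓢(EuclideanSpace ℝ (Fin d), ℂ)) : Integrable (fun x => f x * φ x) :=
  MemLp.integrable_mul (p := 2) (q := 2) (Lp.memLp f) (φ.memLp 2)

theorem ae_eq_of_integral_mul_eq {d : ℕ} {f g : EuclideanSpace ℝ (Fin d) → ℂ}
    (hf : LocallyIntegrable f) (hg : LocallyIntegrable g)
    (h : ∀ φ : EuclideanSpace ℝ (Fin d) → ℂ, ContDiff ℝ ∞ φ → HasCompactSupport φ →
      ∫ x, f x * φ x = ∫ x, g x * φ x) : f =ᵐ[volume] g := by
  refine ae_eq_of_integral_contDiff_smul_eq hf hg ?_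
  intro φ h1 h2
  have k1 : ContDiff ℝ ∞ (fun x => (φ x : ℂ)) := Complex.ofRealCLM.contDiff.comp h1
  have k2 : HasCompactSupport (fun x => (φ x : ℂ)) :=
    h2.comp_left (g := fun r : ℝ => (r : ℂ)) Complex.ofReal_zero
  simpa only [Complex.real_smul, mul_comm] using h _ k1 k2

/-- A weak first order derivative can be tested against Schwartz functions. -/
theorem integral_mul_lineDeriv_schwartz {d : ℕ} (j : Fin d) {f g : L2Space d}
    (h : ∀ φ : EuclideanSpace ℝ (Fin d) → ℂ, ContDiff ℝ ∞ φ → HasCompactSupport φ →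
      ∫ x, f x * partialDeriv j φ x = - ∫ x, g x * φ x)
    (φ : 𝓢(EuclideanSpace ℝ (Fin d), ℂ)) :
    ∫ x, f x * (∂_{EuclideanSpace.single j (1 : ℝ)} φ) x = - ∫ x, g x * φ x := by
  let e : EuclideanSpace ℝ (Fin d) := EuclideanSpace.single j (1 : ℝ)
  -- Cutoffs `χ(c_n x)` with `c_n → 0` make `φ` compactly supported. The error term carries the
  -- derivative of the cutoff, of size `O(c_n)`, and vanishes by dominated convergence.
  obtain ⟨χ⟩ : Nonempty (ContDiffBump (0 : EuclideanSpace ℝ (Fin d))) := inferInstance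
  have hχ : ContDiff ℝ ∞ χ := χ.contDiff
  obtain ⟨C, hC⟩ : ∃ C, ∀ x, ‖fderiv ℝ χ x e‖ ≤ C := by
    have h1 : ContDiff ℝ ∞ (fun x => fderiv ℝ χ x e) :=
      (hχ.fderiv_right (m := ∞) (by simp)).clm_apply contDiff_const
    obtain ⟨C, hC⟩ := (χ.hasCompactSupport.fderiv_apply (𝕜 := ℝ) e).exists_bound_of_continuous
      h1.continuous
    exact ⟨C, hC⟩
  let c : ℕ → ℝ := fun n => 1 / ((n : ℝ) + 1)
  have hc0 : ∀ n, 0 < c n := fun n => by positivity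
  have hc1 : ∀ n, c n ≤ 1 := fun n => by
    rw [div_le_one (by positivity)]; linarith [(Nat.cast_nonneg n : (0 : ℝ) ≤ n)]
  have hct : Filter.Tendsto c Filter.atTop (nhds 0) := tendsto_one_div_add_atTop_nhds_zero_nat
  let X : ℕ → EuclideanSpace ℝ (Fin d) → ℝ := fun n x => χ (c n • x)
  have hX : ∀ n, ContDiff ℝ ∞ (X n) := fun n => hχ.comp (contDiff_id.const_smul (c n))
  have hXs : ∀ n, HasCompactSupport (X n) := fun n =>
    χ.hasCompactSupport.comp_homeomorph (Homeomorph.smulOfNeZero (c n) (hc0 n).ne')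
  have hXd : ∀ n x, fderiv ℝ (X n) x e = c n * fderiv ℝ χ (c n • x) e := by
    intro n x
    have h1 : HasFDerivAt (fun x : EuclideanSpace ℝ (Fin d) => c n • x)
      (c n • ContinuousLinearMap.id ℝ _) x := (hasFDerivAt_id x).const_smul (c n)
    have h2 := (hχ.differentiable (by simp) (c n • x)).hasFDerivAt.comp x h1
    rw [show X n = χ ∘ (fun x => c n • x) from rfl, h2.fderiv]
    simp
  have hlim : ∀ x, Filter.Tendsto (fun n => X n x) Filter.atTop (nhds 1) := by
    intro x
    have h1 : Filter.Tendsto (fun n => c n • x) Filter.atTop (nhds 0) := by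
      simpa using hct.smul_const x
    have h2 := ((χ.continuous.tendsto 0).comp h1)
    have h3 : χ 0 = 1 := χ.one_of_mem_closedBall (by simp [χ.rIn_pos.le])
    rw [h3] at h2
    exact h2
  have hXb : ∀ n x, ‖X n x‖ ≤ 1 := fun n x => by
    rw [Real.norm_of_nonneg χ.nonneg]; exact χ.le_one
  let ψ : ℕ → EuclideanSpace ℝ (Fin d) → ℂ := fun n x => (X n x : ℂ) * φ x
  have hXC : ∀ n, ContDiff ℝ ∞ (fun x => (X n x : ℂ)) := fun n =>
    Complex.ofRealCLM.contDiff.comp (hX n)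
  have hψ : ∀ n, ContDiff ℝ ∞ (ψ n) := fun n => (hXC n).mul (φ.smooth ⊤)
  have hψs : ∀ n, HasCompactSupport (ψ n) := fun n =>
    ((hXs n).comp_left (g := fun r : ℝ => (r : ℂ)) Complex.ofReal_zero).mul_right
  have hψd : ∀ n x, partialDeriv j (ψ n) x =
      (X n x : ℂ) * (∂_{e} φ) x + (fderiv ℝ (X n) x e : ℂ) * φ x := by
    intro n x
    have h1 : HasFDerivAt (fun x => (X n x : ℂ)) (Complex.ofRealCLM.comp (fderiv ℝ (X n) x)) x :=
      Complex.ofRealCLM.hasFDerivAt.comp x ((hX n).differentiable (by simp) x).hasFDerivAt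
    have h2 := h1.mul (φ.differentiableAt (x := x)).hasFDerivAt
    unfold partialDeriv
    change fderiv ℝ ((fun x => (X n x : ℂ)) * ⇑φ) x e = _
    rw [HasFDerivAt.fderiv h2, lineDerivOp_apply_eq_fderiv]
    simp [mul_comm]
  have hd0 : ∀ x, Filter.Tendsto (fun n => fderiv ℝ (X n) x e) Filter.atTop (nhds 0) := by
    intro x
    refine squeeze_zero_norm (a := fun n => c n * C) (fun n => ?_) (by simpa using hct.mul_const C)
    rw [hXd, norm_mul, Real.norm_of_nonneg (hc0 n).le]
    exact mul_le_mul_of_nonneg_left (hC _) (hc0 n).le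
  have hC0 : 0 ≤ C := (norm_nonneg _).trans (hC 0)
  have hdb : ∀ n x, ‖fderiv ℝ (X n) x e‖ ≤ C := by
    intro n x
    rw [hXd, norm_mul, Real.norm_of_nonneg (hc0 n).le]
    exact (mul_le_of_le_one_left (norm_nonneg _) (hc1 n)).trans (hC _)
  have L1 : Filter.Tendsto (fun n => ∫ x, f x * partialDeriv j (ψ n) x) Filter.atTop
      (nhds (∫ x, f x * (∂_{e} φ) x)) := by
    refine tendsto_integral_of_dominated_convergence
      (fun x => ‖f x * (∂_{e} φ) x‖ + C * ‖f x * φ x‖) ?_ ?_ ?_ ?_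
    · intro n
      exact (f.integrable_mul (partialDeriv_smooth j ⟨hψ n, hψs n⟩)).aestronglyMeasurable
    · exact (f.integrable_mul_schwartz _).norm.add ((f.integrable_mul_schwartz φ).norm.const_mul C)
    · intro n
      refine Filter.Eventually.of_forall fun x => ?_
      rw [hψd, mul_add]
      refine (norm_add_le _ _).trans (add_le_add ?_ ?_)
      · rw [mul_left_comm, norm_mul, Complex.norm_real]
        exact mul_le_of_le_one_left (norm_nonneg _) (hXb n x)
      · rw [mul_left_comm, norm_mul, Complex.norm_real]
        exact mul_le_mul_of_nonneg_right (hdb n x) (norm_nonneg _)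
    · refine Filter.Eventually.of_forall fun x => ?_
      have h1 := (Complex.continuous_ofReal.tendsto _).comp (hlim x)
      have h2 := (Complex.continuous_ofReal.tendsto _).comp (hd0 x)
      have h3 := ((h1.mul_const ((∂_{e} φ) x)).add (h2.mul_const (φ x))).const_mul (f x)
      simpa only [hψd, Function.comp_def, Complex.ofReal_one, one_mul, Complex.ofReal_zero,
        zero_mul, add_zero] using h3
  have L2 : Filter.Tendsto (fun n => ∫ x, g x * ψ n x) Filter.atTop (nhds (∫ x, g x * φ x)) := by
    refine tendsto_integral_of_dominated_convergence (fun x => ‖g x * φ x‖) ?_ ?_ ?_ ?_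
    · intro n
      exact (g.integrable_mul ⟨hψ n, hψs n⟩).aestronglyMeasurable
    · exact (g.integrable_mul_schwartz φ).norm
    · intro n
      refine Filter.Eventually.of_forall fun x => ?_
      change ‖g x * ((X n x : ℂ) * φ x)‖ ≤ _
      rw [mul_left_comm, norm_mul, Complex.norm_real]
      exact mul_le_of_le_one_left (norm_nonneg _) (hXb n x)
    · refine Filter.Eventually.of_forall fun x => ?_
      have h1 := (Complex.continuous_ofReal.tendsto _).comp (hlim x)
      have h3 := (h1.mul_const (φ x)).const_mul (g x)
      simpa only [Function.comp_def, Complex.ofReal_one, one_mul] using h3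
  refine tendsto_nhds_unique L1 ?_
  simp_rw [fun n => h (ψ n) (hψ n) (hψs n)]
  exact L2.neg

theorem locallyIntegrable_continuous_mul {d : ℕ} {m : EuclideanSpace ℝ (Fin d) → ℂ}
    (hm : Continuous m) (f : L2Space d) : LocallyIntegrable (fun x => m x * f x) :=
  LocallyIntegrable.continuous_mul hm ((Lp.memLp f).locallyIntegrable (by norm_num))

/-- The Fourier transform turns a weak first order derivative into a multiplication. -/
theorem fourier_of_weakDeriv_first {d : ℕ} (j : Fin d) {f g : L2Space d}
    (h : ∀ φ : EuclideanSpace ℝ (Fin d) → ℂ, ContDiff ℝ ∞ φ → HasCompactSupport φ →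
      ∫ x, f x * partialDeriv j φ x = - ∫ x, g x * φ x) :
    (𝓕 g : L2Space d) =ᵐ[volume]
      fun ξ => (2 * Real.pi * Complex.I * ξ j) * (𝓕 f : L2Space d) ξ := by
  have hm : Continuous fun ξ : EuclideanSpace ℝ (Fin d) => (2 * Real.pi * Complex.I * ξ j) := by
    fun_prop
  refine ae_eq_of_integral_mul_eq ((Lp.memLp _).locallyIntegrable (by norm_num))
    (locallyIntegrable_continuous_mul hm _) ?_
  intro φ h1 h2
  let Φ : 𝓢(EuclideanSpace ℝ (Fin d), ℂ) := h2.toSchwartzMap h1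
  -- `𝓕 Φ` is Schwartz but in general not compactly supported, which is why the weak derivative had
  -- to be tested beyond compact support.
  have key := integral_mul_lineDeriv_schwartz j h (𝓕 Φ)
  rw [lineDerivOp_fourier_eq, ← L2Space.integral_fourier_mul, ← L2Space.integral_fourier_mul] at key
  have hT : (fun x : EuclideanSpace ℝ (Fin d) =>
      inner ℝ x (EuclideanSpace.single j (1 : ℝ))).HasTemperateGrowth := by fun_prop
  change ∫ x, (𝓕 g : L2Space d) x * Φ x = _
  rw [← neg_inj, ← key, ← integral_neg]
  refine integral_congr_ae (Filter.Eventually.of_forall fun x => ?_)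
  change _ * (-(2 * (Real.pi : ℂ) * Complex.I) • (smulLeftCLM ℂ
      (fun x : EuclideanSpace ℝ (Fin d) => inner ℝ x (EuclideanSpace.single j (1 : ℝ))) Φ x)) = -(_ * _ * Φ x)
  rw [ smulLeftCLM_apply_apply hT, EuclideanSpace.inner_single_right]
  simp
  ring

/-- Parseval without conjugation: the multiplication formula applied to `𝓕⁻ φ`. It moves the
defining identity of a weak derivative to the Fourier side. -/
theorem L2Space.integral_mul_eq_fourierInv {d : ℕ} (f : L2Space d)
    {φ : EuclideanSpace ℝ (Fin d) → ℂ} (h1 : ContDiff ℝ ∞ φ) (h2 : HasCompactSupport φ) :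
    ∫ x, f x * φ x = ∫ ξ, (𝓕 f : L2Space d) ξ * 𝓕⁻ φ ξ := by
  let Φ : 𝓢(EuclideanSpace ℝ (Fin d), ℂ) := h2.toSchwartzMap h1
  have e1 := L2Space.integral_fourier_mul f (𝓕⁻ Φ)
  rw [fourier_fourierInv_eq, fourierInv_coe] at e1
  exact e1.symm

/-- An `L²` function with integrable Fourier transform is the inverse Fourier integral. -/
theorem L2Space.ae_eq_fourierInv {d : ℕ} (f : L2Space d)
    (h : Integrable (𝓕 f : L2Space d)) :
    f =ᵐ[volume] 𝓕⁻ ((𝓕 f : L2Space d) : EuclideanSpace ℝ (Fin d) → ℂ) := by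
  have hc : Continuous (𝓕⁻ ((𝓕 f : L2Space d) : EuclideanSpace ℝ (Fin d) → ℂ)) := by
    rw [← Real.Lp.fourierTransformInv_toLp (memLp_one_iff_integrable.mpr h)]
    exact map_continuous _
  refine ae_eq_of_integral_mul_eq ((Lp.memLp _).locallyIntegrable (by norm_num))
    hc.locallyIntegrable ?_
  intro φ h1 h2
  let Φ : 𝓢(EuclideanSpace ℝ (Fin d), ℂ) := h2.toSchwartzMap h1
  rw [L2Space.integral_mul_eq_fourierInv f h1 h2]
  -- With the pairing `-innerₗ` the Fourier integral is `𝓕⁻`; Fubini moves it from one factor to the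
  -- other, and the symmetry of the pairing removes the flip.
  have e2 := VectorFourier.integral_fourierIntegral_smul_eq_flip (μ := volume) (ν := volume)
    (L := -innerₗ (EuclideanSpace ℝ (Fin d)))
    Real.continuous_fourierChar continuous_inner.neg h Φ.integrable
  have e3 : (-innerₗ (EuclideanSpace ℝ (Fin d))).flip = -innerₗ (EuclideanSpace ℝ (Fin d)) := by
    ext x y
    simp [real_inner_comm]
  rw [e3] at e2
  exact e2.symm

/-- The Fourier transform of a classical derivative of a test function. -/
theorem fourierInv_multiDeriv {d : ℕ} (α : Fin d → ℕ) {φ : EuclideanSpace ℝ (Fin d) → ℂ}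
    (h : ContDiff ℝ ∞ φ ∧ HasCompactSupport φ) (ξ : EuclideanSpace ℝ (Fin d)) :
    𝓕⁻ (multiDeriv α φ) ξ = (-1) ^ (∑ j, α j) * derivSymbol α ξ * 𝓕⁻ φ ξ := by
  have step : ∀ (j : Fin d) (ψ : EuclideanSpace ℝ (Fin d) → ℂ),
      ContDiff ℝ ∞ ψ ∧ HasCompactSupport ψ →
      𝓕⁻ (partialDeriv j ψ) ξ = -(2 * Real.pi * Complex.I * ξ j) * 𝓕⁻ ψ ξ := by
    intro j ψ hψ
    let Ψ : 𝓢(EuclideanSpace ℝ (Fin d), ℂ) := hψ.2.toSchwartzMap hψ.1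
    have hT : (fun x : EuclideanSpace ℝ (Fin d) =>
      inner ℝ x (EuclideanSpace.single j (1 : ℝ))).HasTemperateGrowth := by fun_prop
    have e := congrArg (fun T : 𝓢(EuclideanSpace ℝ (Fin d), ℂ) => T ξ)
      (fourierInv_lineDerivOp_eq Ψ (EuclideanSpace.single j (1 : ℝ)))
    change (𝓕⁻ (∂_{EuclideanSpace.single j (1 : ℝ)} Ψ)) ξ = -(2 * (Real.pi : ℂ) * Complex.I) • (smulLeftCLM ℂ
      (fun x : EuclideanSpace ℝ (Fin d) => inner ℝ x (EuclideanSpace.single j (1 : ℝ))) (𝓕⁻ Ψ) ξ) at e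
    rw [smulLeftCLM_apply_apply hT, EuclideanSpace.inner_single_right, fourierInv_coe,
      fourierInv_coe] at e
    change 𝓕⁻ (partialDeriv j ψ) ξ = -(2 * (Real.pi : ℂ) * Complex.I) • (_ • 𝓕⁻ ψ ξ) at e
    rw [e]
    simp
    ring
  have hl : ∀ l : List (Fin d),
      (ContDiff ℝ ∞ (l.foldr (fun j ψ => (partialDeriv j)^[α j] ψ) φ) ∧
        HasCompactSupport (l.foldr (fun j ψ => (partialDeriv j)^[α j] ψ) φ)) ∧
      𝓕⁻ (l.foldr (fun j ψ => (partialDeriv j)^[α j] ψ) φ) ξ =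
        (l.map fun j => (-(2 * Real.pi * Complex.I * ξ j)) ^ α j).prod * 𝓕⁻ φ ξ := by
    intro l
    induction l with
    | nil => exact ⟨h, by simp⟩
    | cons j l ih =>
      rw [List.foldr_cons, List.map_cons, List.prod_cons]
      generalize α j = n
      induction n with
      | zero => simpa using ih
      | succ n ihn =>
        rw [Function.iterate_succ_apply']
        refine ⟨partialDeriv_smooth j ihn.1, ?_⟩
        rw [step j _ ihn.1, ihn.2]
        ring
  have e := (hl (List.finRange d)).2
  rw [← Fin.prod_univ_def] at e
  refine e.trans ?_
  congr 1
  rw [derivSymbol, ← Finset.prod_pow_eq_pow_sum, ← Finset.prod_mul_distrib]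
  refine Finset.prod_congr rfl fun j _ => ?_
  rw [neg_pow]

/-- The fold applies the derivatives in the last coordinates first. When `β` vanishes beyond `j`,
the extra `∂_j` is therefore already the innermost one, and no commutation of partial derivatives is
needed. -/
theorem multiDeriv_add_single {d : ℕ} (β : Fin d → ℕ) (j : Fin d) (hβ : ∀ k, j < k → β k = 0)
    (φ : EuclideanSpace ℝ (Fin d) → ℂ) :
    multiDeriv (β + Pi.single j 1) φ = multiDeriv β (partialDeriv j φ) := by
  obtain ⟨l₁, l₂, hl⟩ := List.append_of_mem (List.mem_finRange j)
  have hs := List.pairwise_lt_finRange d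
  rw [hl, List.pairwise_append, List.pairwise_cons] at hs
  have h2 : ∀ k ∈ l₂, β k = 0 := fun k hk => hβ k (hs.2.1.1 k hk)
  have h2' : ∀ k ∈ l₂, (β + Pi.single j 1 : Fin d → ℕ) k = 0 := fun k hk => by
    rw [Pi.add_apply, h2 k hk, Pi.single_eq_of_ne (hs.2.1.1 k hk).ne', add_zero]
  have h1 : ∀ k ∈ l₁, (β + Pi.single j 1 : Fin d → ℕ) k = β k := fun k hk => by
    rw [Pi.add_apply, Pi.single_eq_of_ne (hs.2.2 k hk j (by simp)).ne, add_zero]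
  have hz : ∀ (γ : Fin d → ℕ) (l : List (Fin d)), (∀ k ∈ l, γ k = 0) →
      ∀ ψ : EuclideanSpace ℝ (Fin d) → ℂ,
        l.foldr (fun j ψ => (partialDeriv j)^[γ j] ψ) ψ = ψ := by
    intro γ l
    induction l with
    | nil => intro _ ψ; rfl
    | cons k l ih =>
      intro hk ψ
      rw [List.foldr_cons, ih (fun i hi => hk i (List.mem_cons_of_mem _ hi)), hk k (by simp)]
      rfl
  unfold multiDeriv
  rw [hl, List.foldr_append, List.foldr_append, List.foldr_cons, List.foldr_cons,
    hz _ _ h2, hz _ _ h2', Pi.add_apply, Pi.single_eq_same, Function.iterate_succ_apply]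
  exact List.foldr_ext _ _ _ (fun k hk ψ => by rw [h1 k hk])

theorem derivSymbol_add_single {d : ℕ} (β : Fin d → ℕ) (j : Fin d)
    (ξ : EuclideanSpace ℝ (Fin d)) :
    derivSymbol (β + Pi.single j 1) ξ = (2 * Real.pi * Complex.I * ξ j) * derivSymbol β ξ := by
  unfold derivSymbol
  simp only [Pi.add_apply, pow_add, Finset.prod_mul_distrib]
  rw [mul_comm]
  congr 1
  rw [Finset.prod_eq_single j]
  · simp
  · intro k _ hk
    simp [Pi.single_eq_of_ne hk]
  · simp

/-- The Fourier transform of the weak derivatives of a Sobolev function. -/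
theorem SobolevSpace.fourier_apply {d : ℕ} {s : ℕ∞} (F : SobolevSpace d s) (α : MultiIndex d s) :
    (𝓕 (F.1 α) : L2Space d) =ᵐ[volume]
      fun ξ => derivSymbol α.1 ξ * (𝓕 (SobolevSpace.toL2 F) : L2Space d) ξ := by
  obtain ⟨α, hα⟩ := α
  induction hn : ∑ j, α j generalizing α with
  | zero =>
    have h0 : α = 0 := by
      funext j
      exact (Finset.sum_eq_zero_iff.mp hn) j (Finset.mem_univ j)
    subst h0
    have e : (F.1 ⟨0, hα⟩ : L2Space d) = SobolevSpace.toL2 F := rfl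
    rw [e]
    simp [derivSymbol]
  | succ n ih =>
    -- The derivative is peeled off at the largest index in the support of `α`, the one applied
    -- first by `multiDeriv`.
    obtain ⟨j, hj, hmax⟩ : ∃ j, α j ≠ 0 ∧ ∀ k, j < k → α k = 0 := by
      have hne : (Finset.univ.filter fun j => α j ≠ 0).Nonempty := by
        by_contra hcon
        rw [Finset.not_nonempty_iff_eq_empty, Finset.filter_eq_empty_iff] at hcon
        have : ∑ j, α j = 0 := Finset.sum_eq_zero fun j hj => by simpa using hcon hj
        omega
      refine ⟨_, (Finset.mem_filter.mp (Finset.max'_mem _ hne)).2, fun k hk => ?_⟩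
      by_contra hk0
      exact absurd (Finset.le_max' _ k (Finset.mem_filter.mpr ⟨Finset.mem_univ k, hk0⟩))
        (not_le.mpr hk)
    obtain ⟨β, rfl⟩ : ∃ β : Fin d → ℕ, α = β + Pi.single j 1 := by
      refine ⟨α - Pi.single j 1, (tsub_add_cancel_of_le ?_).symm⟩
      intro k
      by_cases hk : k = j
      · subst hk; simpa using Nat.one_le_iff_ne_zero.mpr hj
      · simp [Pi.single_eq_of_ne hk]
    have hsum : ∑ k, (β + Pi.single j 1 : Fin d → ℕ) k = ∑ k, β k + 1 := by
      simp [Finset.sum_add_distrib]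
    have hβ : ((∑ k, β k : ℕ) : ℕ∞) ≤ s := by
      refine le_trans ?_ hα
      rw [hsum]
      exact_mod_cast Nat.le_succ _
    -- `D^{β+e_j} f` is the weak `∂_j` of `D^β f`: test the identity for `β` with `∂_j φ`, and
    -- compare with the identity for `β + e_j` tested with `φ`.
    have h1 : ∀ φ : EuclideanSpace ℝ (Fin d) → ℂ, ContDiff ℝ ∞ φ → HasCompactSupport φ →
        ∫ x, (F.1 ⟨β, hβ⟩ : L2Space d) x * partialDeriv j φ x =
          - ∫ x, (F.1 ⟨β + Pi.single j 1, hα⟩ : L2Space d) x * φ x := by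
      intro φ p1 p2
      have q := partialDeriv_smooth j ⟨p1, p2⟩
      have e1 := F.2 ⟨β, hβ⟩ _ q.1 q.2
      have e2 := F.2 ⟨β + Pi.single j 1, hα⟩ φ p1 p2
      dsimp only at e1 e2
      rw [multiDeriv_add_single β j (fun k hk => ?_), hsum] at e2
      · rw [e2, pow_succ, mul_assoc] at e1
        have e3 := mul_left_cancel₀ (pow_ne_zero _ (by norm_num)) e1
        rw [← e3]
        ring
      · have := hmax k hk
        simp only [Pi.add_apply] at this
        omega
    filter_upwards [fourier_of_weakDeriv_first j h1, ih β hβ (by omega)] with ξ k1 k2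
    rw [k1, k2, derivSymbol_add_single]
    ring

/-! ### The weighted Fourier norm and boundedness of the embedding -/

/-- The Fourier weight `∑_{|α| ≤ s} |(2πξ)^α|²` of the Sobolev norm. -/
noncomputable def sobolevWeight (d : ℕ) (s : ℕ∞) (ξ : EuclideanSpace ℝ (Fin d)) : ℝ≥0∞ :=
  ∑' α : MultiIndex d s, ‖derivSymbol α.1 ξ‖ₑ ^ 2

theorem measurable_sobolevWeight (d : ℕ) (s : ℕ∞) : Measurable (sobolevWeight d s) :=
  Measurable.tsum fun α => ((continuous_derivSymbol α.1).measurable.enorm.pow_const 2)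

theorem sobolevWeight_ne_zero (d : ℕ) (s : ℕ∞) (ξ : EuclideanSpace ℝ (Fin d)) :
    sobolevWeight d s ξ ≠ 0 := by
  intro h
  have h0 := ENNReal.tsum_eq_zero.mp h (MultiIndex.zero d s)
  simp [MultiIndex.zero, derivSymbol] at h0

theorem L2Space.enorm_sq {d : ℕ} (f : L2Space d) : ‖f‖ₑ ^ 2 = ∫⁻ x, ‖f x‖ₑ ^ 2 := by
  have h := eLpNorm_nnreal_pow_eq_lintegral (f := f)
    (μ := (volume : Measure (EuclideanSpace ℝ (Fin d)))) (p := 2) (by norm_num)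
  rw [Lp.enorm_def]
  simpa using h

/-- Plancherel for each derivative, then Tonelli to exchange sum and integral. Values in `ℝ≥0∞`
allow the weight to be infinite, as happens for `s = ∞`. -/
theorem SobolevSpace.enorm_sq {d : ℕ} {s : ℕ∞} (F : SobolevSpace d s) :
    ‖F‖ₑ ^ 2 = ∫⁻ ξ, ‖(𝓕 (SobolevSpace.toL2 F) : L2Space d) ξ‖ₑ ^ 2 * sobolevWeight d s ξ := by
  have hs : Summable fun α : MultiIndex d s => ‖F.1 α‖ ^ 2 := by
    have h := (memℓp_gen_iff (p := 2) (by norm_num)).mp (lp.memℓp F.1)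
    simpa using h
  have h1 : ‖F‖ₑ ^ 2 = ∑' α : MultiIndex d s, ‖F.1 α‖ₑ ^ 2 := by
    have h := SobolevSpace.norm_sq_eq F
    rw [← ofReal_norm, ← ENNReal.ofReal_pow (norm_nonneg _), h,
      ENNReal.ofReal_tsum_of_nonneg (fun α => by positivity) hs]
    refine tsum_congr fun α => ?_
    rw [ENNReal.ofReal_pow (norm_nonneg _), ofReal_norm]
  have hm : ∀ α : MultiIndex d s, AEMeasurable fun ξ =>
      ‖(𝓕 (SobolevSpace.toL2 F) : L2Space d) ξ‖ₑ ^ 2 * ‖derivSymbol α.1 ξ‖ₑ ^ 2 := fun α =>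
    ((Lp.aestronglyMeasurable _).enorm.pow_const 2).mul
      ((continuous_derivSymbol α.1).measurable.enorm.pow_const 2).aemeasurable
  rw [h1]
  simp_rw [sobolevWeight, ← ENNReal.tsum_mul_left]
  rw [lintegral_tsum hm]
  refine tsum_congr fun α => ?_
  have e : ‖F.1 α‖ₑ = ‖(𝓕 (F.1 α) : L2Space d)‖ₑ := by
    rw [← ofReal_norm, ← ofReal_norm, Lp.norm_fourier_eq]
  rw [e, L2Space.enorm_sq]
  refine lintegral_congr_ae ?_
  filter_upwards [SobolevSpace.fourier_apply F α] with ξ h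
  rw [h, enorm_mul, mul_pow, mul_comm]

/-- Cauchy–Schwarz for the factorization `|g| = (|g| v^{1/2}) · v^{-1/2}`. -/
theorem SobolevSpace.lintegral_fourier_le {d : ℕ} {s : ℕ∞} (F : SobolevSpace d s) :
    ∫⁻ ξ, ‖(𝓕 (SobolevSpace.toL2 F) : L2Space d) ξ‖ₑ ≤
      ‖F‖ₑ * (∫⁻ ξ, (sobolevWeight d s ξ)⁻¹) ^ (1 / 2 : ℝ) := by
  set g : EuclideanSpace ℝ (Fin d) → ℂ := ((𝓕 (SobolevSpace.toL2 F) : L2Space d) :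
    EuclideanSpace ℝ (Fin d) → ℂ) with hg
  have hgm : AEStronglyMeasurable g := Lp.aestronglyMeasurable _
  have hvm := measurable_sobolevWeight d s
  have hfin : ∫⁻ ξ, ‖g ξ‖ₑ ^ 2 * sobolevWeight d s ξ ≠ ⊤ := by
    rw [hg, ← SobolevSpace.enorm_sq F]
    exact ENNReal.pow_ne_top enorm_ne_top
  -- Where the weight is infinite the factorization reads `∞ · 0`; finiteness of the norm forces `g
  -- = 0` there almost everywhere.
  have hae : ∀ᵐ ξ, ‖g ξ‖ₑ ≤ (‖g ξ‖ₑ * sobolevWeight d s ξ ^ (1 / 2 : ℝ)) *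
      (sobolevWeight d s ξ)⁻¹ ^ (1 / 2 : ℝ) := by
    have hm : AEMeasurable fun ξ => ‖g ξ‖ₑ ^ 2 * sobolevWeight d s ξ :=
      (hgm.enorm.pow_const 2).mul hvm.aemeasurable
    filter_upwards [ae_lt_top' hm hfin] with ξ hξ
    rcases eq_or_ne (sobolevWeight d s ξ) ∞ with h | h
    · rw [h] at hξ
      have h0 : ‖g ξ‖ₑ = 0 := by
        by_contra h0
        rw [ENNReal.mul_top (pow_ne_zero _ h0)] at hξ
        exact lt_irrefl _ hξ
      rw [h0]
      exact zero_le
    · rw [mul_assoc, ← ENNReal.mul_rpow_of_nonneg _ _ (by norm_num : (0 : ℝ) ≤ 1 / 2),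
        ENNReal.mul_inv_cancel (sobolevWeight_ne_zero d s ξ) h, ENNReal.one_rpow, mul_one]
  refine (lintegral_mono_ae hae).trans ?_
  refine (ENNReal.lintegral_mul_le_Lp_mul_Lq volume Real.HolderConjugate.two_two
    (hgm.enorm.mul (hvm.pow_const _).aemeasurable) (hvm.inv.pow_const _).aemeasurable).trans
    (le_of_eq ?_)
  have p2 : ∀ x : ℝ≥0∞, (x ^ (1 / 2 : ℝ)) ^ (2 : ℝ) = x := fun x => by
    rw [← ENNReal.rpow_mul]; norm_num
  congr 1
  · have h1 : ∀ ξ, (‖g ξ‖ₑ * sobolevWeight d s ξ ^ (1 / 2 : ℝ)) ^ (2 : ℝ) =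
        ‖g ξ‖ₑ ^ 2 * sobolevWeight d s ξ := fun ξ => by
      rw [ENNReal.mul_rpow_of_nonneg _ _ (by norm_num : (0 : ℝ) ≤ 2), p2, ENNReal.rpow_two]
    simp_rw [Pi.mul_apply, h1]
    rw [hg, ← SobolevSpace.enorm_sq F, ← ENNReal.rpow_two, ← ENNReal.rpow_mul]
    norm_num
  · simp_rw [p2, Pi.inv_apply]

theorem SobolevSpace.integrable_fourier {d : ℕ} {s : ℕ∞}
    (hK : ∫⁻ ξ, (sobolevWeight d s ξ)⁻¹ ≠ ⊤) (F : SobolevSpace d s) :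
    Integrable (𝓕 (SobolevSpace.toL2 F) : L2Space d) :=
  ⟨Lp.aestronglyMeasurable _, (SobolevSpace.lintegral_fourier_le F).trans_lt
    (ENNReal.mul_lt_top enorm_lt_top (ENNReal.rpow_lt_top_of_nonneg (by norm_num) hK))⟩

theorem SobolevSpace.eLpNorm_top_le {d : ℕ} {s : ℕ∞}
    (hK : ∫⁻ ξ, (sobolevWeight d s ξ)⁻¹ ≠ ⊤) (F : SobolevSpace d s) :
    eLpNorm (SobolevSpace.toL2 F) ∞ volume ≤
      ‖F‖ₑ * (∫⁻ ξ, (sobolevWeight d s ξ)⁻¹) ^ (1 / 2 : ℝ) := by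
  refine le_trans ?_ (SobolevSpace.lintegral_fourier_le F)
  rw [eLpNorm_congr_ae (L2Space.ae_eq_fourierInv _ (SobolevSpace.integrable_fourier hK F)),
    eLpNorm_exponent_top]
  refine essSup_le_of_ae_le _ (Filter.Eventually.of_forall fun x => ?_)
  dsimp only
  rw [Real.fourierInv_eq]
  refine (enorm_integral_le_lintegral_enorm _).trans (le_of_eq ?_)
  refine lintegral_congr fun ξ => ?_
  rw [← ofReal_norm, ← ofReal_norm, Circle.norm_smul]

/-- The embedding into `L_∞` exists and is bounded by the square root of `∫ 1 / weight`. -/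
theorem exists_isLinftyEmbedding {d : ℕ} {s : ℕ∞}
    (hK : ∫⁻ ξ, (sobolevWeight d s ξ)⁻¹ ≠ ⊤) :
    ∃ I : SobolevSpace d s →L[ℂ] LinftySpace d, IsLinftyEmbedding I ∧
      ‖I‖ ≤ √(∫⁻ ξ, (sobolevWeight d s ξ)⁻¹).toReal := by
  have hmem : ∀ F : SobolevSpace d s, MemLp (SobolevSpace.toL2 F) ∞ volume := fun F =>
    ⟨Lp.aestronglyMeasurable _, (SobolevSpace.eLpNorm_top_le hK F).trans_lt
      (ENNReal.mul_lt_top enorm_lt_top (ENNReal.rpow_lt_top_of_nonneg (by norm_num) hK))⟩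
  let L : SobolevSpace d s →ₗ[ℂ] LinftySpace d :=
    { toFun := fun F => (hmem F).toLp
      map_add' := by
        intro F G
        apply Lp.ext
        filter_upwards [(hmem (F + G)).coeFn_toLp, (hmem F).coeFn_toLp, (hmem G).coeFn_toLp,
          Lp.coeFn_add (hmem F).toLp (hmem G).toLp,
          Lp.coeFn_add (SobolevSpace.toL2 F) (SobolevSpace.toL2 G)] with x h1 h2 h3 h4 h5
        rw [h1, h4, Pi.add_apply, h2, h3, ← Pi.add_apply, ← h5]
        rfl
      map_smul' := by
        intro c F
        apply Lp.ext
        filter_upwards [(hmem (c • F)).coeFn_toLp, (hmem F).coeFn_toLp,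
          Lp.coeFn_smul c (hmem F).toLp, Lp.coeFn_smul c (SobolevSpace.toL2 F)] with x h1 h2 h3 h4
        rw [h1, RingHom.id_apply, h3, Pi.smul_apply, h2, ← Pi.smul_apply, ← h4]
        rfl }
  have hL : ∀ F, ‖L F‖ ≤ √(∫⁻ ξ, (sobolevWeight d s ξ)⁻¹).toReal * ‖F‖ := by
    intro F
    have h := ENNReal.toReal_mono (ENNReal.mul_ne_top enorm_ne_top
      (ENNReal.rpow_ne_top_of_nonneg (by norm_num) hK)) (SobolevSpace.eLpNorm_top_le hK F)
    rw [ENNReal.toReal_mul, ← ENNReal.toReal_rpow, ← Real.sqrt_eq_rpow, toReal_enorm,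
      mul_comm] at h
    exact (Lp.norm_toLp _ (hmem F)).trans_le h
  exact ⟨L.mkContinuous _ hL, fun F => (hmem F).coeFn_toLp,
    L.mkContinuous_norm_le (Real.sqrt_nonneg _) hL⟩

theorem SobolevSpace.exists_restrict {d : ℕ} {s t : ℕ∞} (hst : s ≤ t) (F : SobolevSpace d t) :
    ∃ G : SobolevSpace d s, SobolevSpace.toL2 G = SobolevSpace.toL2 F ∧ ‖G‖ ≤ ‖F‖ := by
  let ι : MultiIndex d s → MultiIndex d t := fun α => ⟨α.1, α.2.trans hst⟩
  have hι : Function.Injective ι := fun α β h => Subtype.ext (congrArg (fun γ : MultiIndex d t => γ.1) h)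
  have hF : Summable fun α : MultiIndex d t => ‖F.1 α‖ ^ 2 := by
    have h := (memℓp_gen_iff (p := 2) (by norm_num)).mp (lp.memℓp F.1)
    simpa using h
  have hG : Memℓp (fun α : MultiIndex d s => (F.1 (ι α) : L2Space d)) 2 := by
    refine memℓp_gen ?_
    simpa using! hF.comp_injective hι
  let G : SobolevSpace d s := ⟨⟨_, hG⟩, fun α => F.2 (ι α)⟩
  refine ⟨G, rfl, ?_⟩
  rw [← sq_le_sq₀ (norm_nonneg _) (norm_nonneg _), SobolevSpace.norm_sq_eq,
    SobolevSpace.norm_sq_eq]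
  exact (hF.comp_injective hι).tsum_le_tsum_of_inj ι hι (fun _ _ => by positivity)
    (fun _ => le_rfl) hF

/-- The embedding constants decrease with the smoothness. -/
theorem IsLinftyEmbedding.norm_le {d : ℕ} {s t : ℕ∞} (hst : s ≤ t)
    {I : SobolevSpace d s →L[ℂ] LinftySpace d} {J : SobolevSpace d t →L[ℂ] LinftySpace d}
    (hI : IsLinftyEmbedding I) (hJ : IsLinftyEmbedding J) : ‖J‖ ≤ ‖I‖ := by
  refine J.opNorm_le_bound I.opNorm_nonneg fun F => ?_
  obtain ⟨G, h1, h2⟩ := SobolevSpace.exists_restrict hst F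
  have e : J F = I G := Lp.ext ((hJ F).trans (h1 ▸ (hI G).symm))
  rw [e]
  exact (I.le_opNorm G).trans (mul_le_mul_of_nonneg_left h2 I.opNorm_nonneg)

/-! ### The extremal function and the exact norm -/

theorem memLp_two_of_lintegral_enorm_sq_ne_top {d : ℕ} {f : EuclideanSpace ℝ (Fin d) → ℂ}
    (hf : AEStronglyMeasurable f) (h : ∫⁻ x, ‖f x‖ₑ ^ 2 ≠ ⊤) : MemLp f 2 := by
  refine ⟨hf, ?_⟩
  rw [eLpNorm_lt_top_iff_lintegral_rpow_enorm_lt_top (by norm_num) (by norm_num)]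
  simpa using h.lt_top

theorem enorm_toReal_inv_sobolevWeight {d : ℕ} {s : ℕ∞} (ξ : EuclideanSpace ℝ (Fin d)) :
    ‖(((sobolevWeight d s ξ)⁻¹.toReal : ℝ) : ℂ)‖ₑ = (sobolevWeight d s ξ)⁻¹ := by
  rw [← ofReal_norm, Complex.norm_real, Real.norm_of_nonneg ENNReal.toReal_nonneg,
    ENNReal.ofReal_toReal (ENNReal.inv_ne_top.mpr (sobolevWeight_ne_zero d s ξ))]

theorem inv_sobolevWeight_sq_mul {d : ℕ} {s : ℕ∞} (ξ : EuclideanSpace ℝ (Fin d)) :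
    (sobolevWeight d s ξ)⁻¹ ^ 2 * sobolevWeight d s ξ = (sobolevWeight d s ξ)⁻¹ := by
  rcases eq_or_ne (sobolevWeight d s ξ) ⊤ with h | h
  · simp [h]
  · rw [sq, mul_assoc, ENNReal.inv_mul_cancel (sobolevWeight_ne_zero d s ξ) h, mul_one]

/-- The Sobolev function whose Fourier transform is the inverse weight. -/
theorem exists_fourier_eq_inv_sobolevWeight {d : ℕ} {s : ℕ∞}
    (hK : ∫⁻ ξ, (sobolevWeight d s ξ)⁻¹ ≠ ⊤) :
    ∃ F : SobolevSpace d s, (𝓕 (SobolevSpace.toL2 F) : L2Space d) =ᵐ[volume]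
      fun ξ => (((sobolevWeight d s ξ)⁻¹.toReal : ℝ) : ℂ) := by
  let h : MultiIndex d s → EuclideanSpace ℝ (Fin d) → ℂ := fun α ξ =>
    derivSymbol α.1 ξ * (((sobolevWeight d s ξ)⁻¹.toReal : ℝ) : ℂ)
  have hmeas : ∀ α, Measurable (h α) := fun α =>
    (continuous_derivSymbol α.1).measurable.mul
      (Complex.measurable_ofReal.comp (measurable_sobolevWeight d s).inv.ennreal_toReal)
  -- Summing over `α` turns `∑ |symbol|² v⁻²` into `v⁻² · v = v⁻¹`. This one identity gives square
  -- integrability of each member and summability of the family.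
  have hsum : ∑' α, ∫⁻ ξ, ‖h α ξ‖ₑ ^ 2 = ∫⁻ ξ, (sobolevWeight d s ξ)⁻¹ := by
    rw [← lintegral_tsum fun α => ((hmeas α).enorm.pow_const 2).aemeasurable]
    refine lintegral_congr fun ξ => ?_
    simp_rw [h, enorm_mul, mul_pow, enorm_toReal_inv_sobolevWeight]
    rw [ENNReal.tsum_mul_right, mul_comm]
    exact inv_sobolevWeight_sq_mul ξ
  have hmem : ∀ α, MemLp (h α) 2 := fun α =>
    memLp_two_of_lintegral_enorm_sq_ne_top (hmeas α).aestronglyMeasurable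
      (ENNReal.ne_top_of_tsum_ne_top (hsum ▸ hK) α)
  let H : MultiIndex d s → L2Space d := fun α => (hmem α).toLp
  have hH : ∀ α, H α =ᵐ[volume] h α := fun α => (hmem α).coeFn_toLp
  have hHsq : ∀ α, ‖H α‖ₑ ^ 2 = ∫⁻ ξ, ‖h α ξ‖ₑ ^ 2 := fun α => by
    rw [L2Space.enorm_sq]
    refine lintegral_congr_ae ?_
    filter_upwards [hH α] with ξ hξ
    rw [hξ]
  let G : MultiIndex d s → L2Space d := fun α => 𝓕⁻ (H α)
  have hG : ∀ α, 𝓕 (G α) = H α := fun α => fourier_fourierInv_eq _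
  have hGl : Memℓp G 2 := by
    refine memℓp_gen ?_
    have e : ∀ α, ‖G α‖ ^ (2 : ℝ≥0∞).toReal = (∫⁻ ξ, ‖h α ξ‖ₑ ^ 2).toReal := fun α => by
      rw [← hHsq, ← hG, ENNReal.toReal_pow, toReal_enorm, Lp.norm_fourier_eq]
      norm_num
    simp_rw [e]
    exact ENNReal.summable_toReal (hsum ▸ hK)
  have hw : ∀ α : MultiIndex d s, IsWeakDeriv α.1 (G (MultiIndex.zero d s)) (G α) := by
    intro α φ h1 h2
    have hD := multiDeriv_smooth α.1 ⟨h1, h2⟩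
    rw [L2Space.integral_mul_eq_fourierInv _ hD.1 hD.2, L2Space.integral_mul_eq_fourierInv _ h1 h2,
      hG, hG, ← integral_const_mul]
    refine integral_congr_ae ?_
    filter_upwards [hH α, hH (MultiIndex.zero d s)] with ξ k1 k2
    rw [k1, k2, fourierInv_multiDeriv _ ⟨h1, h2⟩]
    simp only [h, MultiIndex.zero, derivSymbol, Pi.zero_apply, pow_zero, Finset.prod_const_one]
    ring
  refine ⟨⟨⟨G, hGl⟩, hw⟩, ?_⟩
  change (𝓕 (G (MultiIndex.zero d s)) : L2Space d) =ᵐ[volume] _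
  rw [hG]
  filter_upwards [hH (MultiIndex.zero d s)] with ξ k
  rw [k]
  simp [h, MultiIndex.zero, derivSymbol]

/-- The set where the bound holds is closed and of full measure, hence everything. This allows
evaluation of the extremal function at a point. -/
theorem norm_le_of_ae_eq_continuous {d : ℕ} (f : LinftySpace d)
    {c : EuclideanSpace ℝ (Fin d) → ℂ} (hc : Continuous c) (h : f =ᵐ[volume] c)
    (x : EuclideanSpace ℝ (Fin d)) : ‖c x‖ ≤ ‖f‖ := by
  have h1 : ∀ᵐ x, ‖c x‖ ≤ ‖f‖ := by
    have h2 : ∀ᵐ x, ‖f x‖ₑ ≤ eLpNorm f ⊤ volume := by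
      rw [eLpNorm_exponent_top]
      exact enorm_ae_le_eLpNormEssSup _ _
    filter_upwards [h, h2] with x e1 e2
    rw [← e1, Lp.norm_def, ← toReal_enorm]
    exact ENNReal.toReal_mono (Lp.eLpNorm_ne_top f) e2
  have h3 : IsClosed {x | ‖c x‖ ≤ ‖f‖} := isClosed_le hc.norm continuous_const
  have h4 := (Measure.dense_of_ae h1).closure_eq
  rw [h3.closure_eq] at h4
  exact h4.symm.subset (Set.mem_univ x)

/-- The norm of the embedding into `L_∞`. -/
theorem IsLinftyEmbedding.norm_eq {d : ℕ} {s : ℕ∞}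
    (hK : ∫⁻ ξ, (sobolevWeight d s ξ)⁻¹ ≠ ⊤) {I : SobolevSpace d s →L[ℂ] LinftySpace d}
    (hI : IsLinftyEmbedding I) :
    ‖I‖ = √(∫⁻ ξ, (sobolevWeight d s ξ)⁻¹).toReal := by
  set K := (∫⁻ ξ, (sobolevWeight d s ξ)⁻¹).toReal with hKdef
  have hK0 : 0 ≤ K := ENNReal.toReal_nonneg
  refine le_antisymm ?_ ?_
  · obtain ⟨J, hJ, hn⟩ := exists_isLinftyEmbedding hK
    rwa [hI.unique hJ]
  -- The extremal function has norm `√K` and value `∫ 1/v = K` at the origin, so `K ≤ ‖I‖ √K`.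
  · obtain ⟨F, hF⟩ := exists_fourier_eq_inv_sobolevWeight hK
    have hnorm : ‖F‖ ^ 2 = K := by
      rw [hKdef, ← toReal_enorm, ← ENNReal.toReal_pow, SobolevSpace.enorm_sq]
      congr 1
      refine lintegral_congr_ae ?_
      filter_upwards [hF] with ξ hξ
      rw [hξ, enorm_toReal_inv_sobolevWeight, inv_sobolevWeight_sq_mul]
    have hint := SobolevSpace.integrable_fourier hK F
    have hc : Continuous
        (𝓕⁻ ((𝓕 (SobolevSpace.toL2 F) : L2Space d) : EuclideanSpace ℝ (Fin d) → ℂ)) := by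
      rw [← Real.Lp.fourierTransformInv_toLp (memLp_one_iff_integrable.mpr hint)]
      exact map_continuous _
    have h0 := norm_le_of_ae_eq_continuous (I F) hc
      ((hI F).trans (L2Space.ae_eq_fourierInv _ hint)) 0
    have hval : 𝓕⁻ ((𝓕 (SobolevSpace.toL2 F) : L2Space d) : EuclideanSpace ℝ (Fin d) → ℂ) 0
        = (K : ℂ) := by
      rw [Real.fourierInv_eq]
      simp only [inner_zero_right, AddChar.map_zero_eq_one, one_smul]
      rw [integral_congr_ae hF, integral_complex_ofReal, integral_toReal
        (f := fun ξ => (sobolevWeight d s ξ)⁻¹) (measurable_sobolevWeight d s).inv.aemeasurable]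
      exact Filter.Eventually.of_forall fun ξ =>
        (ENNReal.inv_ne_top.mpr (sobolevWeight_ne_zero d s ξ)).lt_top
    rw [hval, Complex.norm_real, Real.norm_of_nonneg hK0] at h0
    have h1 := h0.trans (I.le_opNorm F)
    have hF' : ‖F‖ = √K := by rw [← hnorm, Real.sqrt_sq (norm_nonneg _)]
    rw [hF'] at h1
    rcases hK0.eq_or_lt with h | h
    · rw [← h, Real.sqrt_zero]
      exact I.opNorm_nonneg
    · have hs := Real.sqrt_pos.mpr h
      refine le_of_mul_le_mul_right ?_ hs
      rwa [Real.mul_self_sqrt hK0]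

/-! ### The case `s = ∞` -/

theorem ENNReal.tsum_pi_prod {d : ℕ} (f : Fin d → ℕ → ℝ≥0∞) :
    ∑' α : Fin d → ℕ, ∏ j, f j (α j) = ∏ j, ∑' n, f j n := by
  induction d with
  | zero => simp
  | succ d ih =>
    rw [← (Fin.consEquiv fun _ => ℕ).tsum_eq, ENNReal.tsum_prod', Fin.prod_univ_succ, ← ih]
    simp only [Fin.consEquiv_apply, Fin.prod_univ_succ, Fin.cons_zero, Fin.cons_succ]
    simp_rw [ENNReal.tsum_mul_left, ENNReal.tsum_mul_right]

/-- The sum over all `α` factors into geometric series in `(2πξ_j)²`. In `ℝ≥0∞` such a series is `(1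
- y)⁻¹` with truncated subtraction, also for `y ≥ 1`, and truncation becomes `max 0`. -/
theorem inv_sobolevWeight_top (d : ℕ) (ξ : EuclideanSpace ℝ (Fin d)) :
    (sobolevWeight d ⊤ ξ)⁻¹ =
      ENNReal.ofReal (∏ j, max 0 (1 - (2 * Real.pi * ξ j) ^ 2)) := by
  have e1 : sobolevWeight d ⊤ ξ =
      ∑' α : Fin d → ℕ, ∏ j, ENNReal.ofReal ((2 * Real.pi * ξ j) ^ 2) ^ α j := by
    let e : (Fin d → ℕ) ≃ MultiIndex d ⊤ := (Equiv.subtypeUnivEquiv fun _ => le_top).symm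
    rw [sobolevWeight, ← e.tsum_eq]
    refine tsum_congr fun α => ?_
    change ‖derivSymbol α ξ‖ₑ ^ 2 = _
    rw [derivSymbol, ← ofReal_norm, norm_prod, ← ENNReal.ofReal_pow (by positivity),
      ← Finset.prod_pow, ENNReal.ofReal_prod_of_nonneg (fun _ _ => by positivity)]
    refine Finset.prod_congr rfl fun j _ => ?_
    rw [← ENNReal.ofReal_pow (by positivity), norm_pow, ← pow_mul, mul_comm (α j), pow_mul]
    congr 2
    simp [mul_pow, Real.norm_eq_abs, sq_abs]
  rw [e1, ENNReal.tsum_pi_prod fun j n => ENNReal.ofReal ((2 * Real.pi * ξ j) ^ 2) ^ n,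
    ENNReal.ofReal_prod_of_nonneg (fun _ _ => le_max_left _ _)]
  simp_rw [ENNReal.tsum_geometric]
  rw [ENNReal.prod_inv_distrib]
  · refine Finset.prod_congr rfl fun j _ => ?_
    rw [inv_inv, ENNReal.ofReal_max, ENNReal.ofReal_zero, max_eq_right zero_le,
      ENNReal.ofReal_sub _ (by positivity), ENNReal.ofReal_one]
  -- No product `0 · ∞` arises: each `(1 - y)⁻¹` is nonzero because `1 - y` is finite.
  · intro i _ j _ _
    left
    simp

theorem integral_max_zero_one_sub_sq :
    Integrable (fun x : ℝ => max 0 (1 - (2 * Real.pi * x) ^ 2)) ∧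
      ∫ x : ℝ, max 0 (1 - (2 * Real.pi * x) ^ 2) = 2 / (3 * Real.pi) := by
  have hpi := Real.pi_pos
  -- The positive zero of `1 - (2πx)²`.
  set a : ℝ := 1 / (2 * Real.pi) with ha
  have ha0 : 0 < a := by positivity
  have hpa : 2 * Real.pi * a = 1 := by rw [ha]; field_simp
  have e : (fun x : ℝ => max 0 (1 - (2 * Real.pi * x) ^ 2)) =
      (Set.Ioc (-a) a).indicator fun x => 1 - (2 * Real.pi * x) ^ 2 := by
    funext x
    by_cases hx : x ∈ Set.Ioc (-a) a
    · rw [Set.indicator_of_mem hx, max_eq_right]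
      have h1 : 2 * Real.pi * x ≤ 1 := by rw [← hpa]; gcongr; exact hx.2
      have h2 : -1 ≤ 2 * Real.pi * x := by
        rw [← hpa, ← mul_neg]; gcongr; exact hx.1.le
      nlinarith
    · rw [Set.indicator_of_notMem hx, max_eq_left]
      rw [Set.mem_Ioc, not_and_or, not_lt, not_le] at hx
      rcases hx with hx | hx
      · have : 2 * Real.pi * x ≤ -1 := by
          rw [← hpa, ← mul_neg]; gcongr
        nlinarith
      · have : 1 ≤ 2 * Real.pi * x := by
          rw [← hpa]; gcongr
        nlinarith
  have hcont : Continuous fun x : ℝ => 1 - (2 * Real.pi * x) ^ 2 := by fun_prop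
  rw [e]
  constructor
  · exact (hcont.integrableOn_Ioc).integrable_indicator measurableSet_Ioc
  · rw [integral_indicator measurableSet_Ioc, ← intervalIntegral.integral_of_le (by linarith)]
    have hd : ∀ x ∈ Set.uIcc (-a) a, HasDerivAt
        (fun x : ℝ => x - (2 * Real.pi) ^ 2 * x ^ 3 / 3) (1 - (2 * Real.pi * x) ^ 2) x := by
      intro x _
      have := (hasDerivAt_id x).sub (((hasDerivAt_pow 3 x).const_mul ((2 * Real.pi) ^ 2)).div_const 3)
      refine this.congr_deriv ?_
      push_cast
      ring
    rw [intervalIntegral.integral_eq_sub_of_hasDerivAt hd (hcont.intervalIntegrable _ _), ha]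
    field_simp
    ring

theorem lintegral_inv_sobolevWeight_top (d : ℕ) :
    ∫⁻ ξ, (sobolevWeight d ⊤ ξ)⁻¹ = ENNReal.ofReal ((2 / (3 * Real.pi)) ^ d) := by
  obtain ⟨h1, h2⟩ := integral_max_zero_one_sub_sq
  have hm := EuclideanSpace.volume_preserving_symm_measurableEquiv_toLp (Fin d)
  simp_rw [inv_sobolevWeight_top]
  have hint : Integrable fun x : Fin d → ℝ => ∏ j, max 0 (1 - (2 * Real.pi * x j) ^ 2) :=
    Integrable.fintype_prod (f := fun (_ : Fin d) x => max 0 (1 - (2 * Real.pi * x) ^ 2))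
      fun _ => h1
  have hint' : Integrable fun ξ : EuclideanSpace ℝ (Fin d) =>
      ∏ j, max 0 (1 - (2 * Real.pi * ξ j) ^ 2) := hm.integrable_comp_of_integrable hint
  rw [← ofReal_integral_eq_lintegral_ofReal hint'
    (Filter.Eventually.of_forall fun ξ => Finset.prod_nonneg fun _ _ => le_max_left _ _)]
  congr 1
  have e := hm.integral_comp (MeasurableEquiv.measurableEmbedding _)
    (fun x : Fin d → ℝ => ∏ j, max 0 (1 - (2 * Real.pi * x j) ^ 2))
  refine e.trans ?_
  rw [integral_fintype_prod_volume_eq_prod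
    (fun (_ : Fin d) (x : ℝ) => max 0 (1 - (2 * Real.pi * x) ^ 2))]
  rw [h2, Finset.prod_const, Finset.card_univ, Fintype.card_fin]

/-! ### Finite smoothness: bounding the integral of the inverse weight -/

/-- In the multinomial expansion each coefficient `k!/α!` is at most `k!`. -/
theorem pow_sum_div_factorial_le {d : ℕ} (k : ℕ) {y : Fin d → ℝ} (hy : ∀ j, 0 ≤ y j) :
    (∑ j, y j) ^ k / (k.factorial : ℝ) ≤
      ∑ α ∈ Finset.piAntidiag (Finset.univ : Finset (Fin d)) k, ∏ j, y j ^ α j := by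
  rw [div_le_iff₀ (by positivity), Finset.sum_pow_eq_sum_piAntidiag, Finset.sum_mul]
  refine Finset.sum_le_sum fun α hα => ?_
  rw [mul_comm]
  refine mul_le_mul_of_nonneg_left ?_ (Finset.prod_nonneg fun j _ => pow_nonneg (hy j) _)
  have h : ∑ j, α j = k := (Finset.mem_piAntidiag.mp hα).1
  rw [← h]
  exact_mod_cast Nat.div_le_self _ _

/-- All degrees other than `k` and `l` are dropped; the result is a radial minorant, one term
controlling small and the other large `|ξ|`. -/
theorem ofReal_le_sobolevWeight {d s k l : ℕ} (hkl : k < l) (hl : l ≤ s)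
    (ξ : EuclideanSpace ℝ (Fin d)) :
    ENNReal.ofReal ((2 * Real.pi * ‖ξ‖) ^ (2 * k) / (k.factorial : ℝ) +
      (2 * Real.pi * ‖ξ‖) ^ (2 * l) / (l.factorial : ℝ)) ≤ sobolevWeight d s ξ := by
  classical
  let y : Fin d → ℝ := fun j => (2 * Real.pi * ξ j) ^ 2
  have hy : ∀ j, 0 ≤ y j := fun j => sq_nonneg _
  have hsum : ∑ j, y j = (2 * Real.pi * ‖ξ‖) ^ 2 := by
    simp only [y, mul_pow, EuclideanSpace.norm_sq_eq, Real.norm_eq_abs, sq_abs, Finset.mul_sum]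
  have e : ∀ α : Fin d → ℕ, ‖derivSymbol α ξ‖ₑ ^ 2 = ENNReal.ofReal (∏ j, y j ^ α j) := by
    intro α
    rw [derivSymbol, ← ofReal_norm, norm_prod, ← ENNReal.ofReal_pow (by positivity),
      ← Finset.prod_pow]
    congr 1
    refine Finset.prod_congr rfl fun j _ => ?_
    rw [norm_pow, ← pow_mul, mul_comm (α j), pow_mul]
    congr 1
    simp [y, mul_pow, Real.norm_eq_abs, sq_abs]
  have hp : ∀ α : Fin d → ℕ, 0 ≤ ∏ j, y j ^ α j := fun α =>
    Finset.prod_nonneg fun j _ => pow_nonneg (hy j) _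
  have hdisj : Disjoint (Finset.piAntidiag (Finset.univ : Finset (Fin d)) k)
      (Finset.piAntidiag Finset.univ l) := by
    rw [Finset.disjoint_left]
    intro α h1 h2
    have h3 := (Finset.mem_piAntidiag.mp h1).1
    have h4 := (Finset.mem_piAntidiag.mp h2).1
    omega
  set T := (Finset.piAntidiag (Finset.univ : Finset (Fin d)) k).disjUnion
      (Finset.piAntidiag Finset.univ l) hdisj with hT
  have hTs : ∀ α ∈ T, α ∈ {α : Fin d → ℕ | ((∑ j, α j : ℕ) : ℕ∞) ≤ (s : ℕ∞)} := by
    intro α hα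
    have h1 : ∑ j, α j ≤ s := by
      rcases Finset.mem_disjUnion.mp hα with h | h
      · exact ((Finset.mem_piAntidiag.mp h).1.trans_le hkl.le).trans hl
      · exact (Finset.mem_piAntidiag.mp h).1.trans_le hl
    exact_mod_cast h1
  calc _ ≤ ENNReal.ofReal (∑ α ∈ T, ∏ j, y j ^ α j) := by
        refine ENNReal.ofReal_le_ofReal ?_
        rw [hT, Finset.sum_disjUnion, pow_mul, pow_mul, ← hsum]
        exact add_le_add (pow_sum_div_factorial_le k hy) (pow_sum_div_factorial_le l hy)
    _ = ∑ α ∈ T, ‖derivSymbol α ξ‖ₑ ^ 2 := by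
        rw [ENNReal.ofReal_sum_of_nonneg fun α _ => hp α]
        exact Finset.sum_congr rfl fun α _ => (e α).symm
    _ = ∑ α ∈ T, {α : Fin d → ℕ | ((∑ j, α j : ℕ) : ℕ∞) ≤ (s : ℕ∞)}.indicator
          (fun α => ‖derivSymbol α ξ‖ₑ ^ 2) α :=
        Finset.sum_congr rfl fun α hα => by rw [Set.indicator_of_mem (hTs α hα)]
    _ ≤ ∑' α, {α : Fin d → ℕ | ((∑ j, α j : ℕ) : ℕ∞) ≤ (s : ℕ∞)}.indicator
          (fun α => ‖derivSymbol α ξ‖ₑ ^ 2) α := ENNReal.sum_le_tsum T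
    _ = sobolevWeight d s ξ := (tsum_subtype _ _).symm

/-- Bound for the integral of the inverse weight in polar coordinates. -/
theorem lintegral_inv_sobolevWeight_le {d s k l : ℕ} (hd : 0 < d) (hkl : k < l) (hl : l ≤ s)
    {g g' : ℝ → ℝ} {L : ℝ} (hg : ∀ r ∈ Set.Ici (0 : ℝ), HasDerivAt g (g' r) r) (hg0 : g 0 = 0)
    (hL : Filter.Tendsto g Filter.atTop (nhds L))
    (hg' : ∀ r ∈ Set.Ioi (0 : ℝ), r ^ (d - 1) * ((2 * Real.pi * r) ^ (2 * k) / (k.factorial : ℝ) +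
      (2 * Real.pi * r) ^ (2 * l) / (l.factorial : ℝ))⁻¹ = g' r) :
    ∫⁻ ξ, (sobolevWeight d s ξ)⁻¹ ≤
      ENNReal.ofReal (d * (√Real.pi ^ d / Real.Gamma ((d : ℝ) / 2 + 1) * L)) := by
  have hpi := Real.pi_pos
  have : Nonempty (Fin d) := Fin.pos_iff_nonempty.mp hd
  have : Nontrivial (EuclideanSpace ℝ (Fin d)) := by
    refine Module.nontrivial_of_finrank_pos (R := ℝ) ?_
    rwa [finrank_euclideanSpace_fin]
  let G : ℝ → ℝ := fun r => ((2 * Real.pi * r) ^ (2 * k) / (k.factorial : ℝ) +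
      (2 * Real.pi * r) ^ (2 * l) / (l.factorial : ℝ))⁻¹
  have hGp : ∀ r, 0 ≤ r → 0 ≤ G r := fun r hr => by positivity
  have hpos : ∀ r ∈ Set.Ioi (0 : ℝ), 0 ≤ g' r := by
    intro r hr
    have hr' : 0 < r := hr
    rw [← hg' r hr]
    positivity
  have hint1 : IntegrableOn (fun r : ℝ => r ^ (d - 1) • G r) (Set.Ioi 0) :=
    (integrableOn_congr_fun (fun r hr => (hg' r hr).symm) measurableSet_Ioi).mp
      (integrableOn_Ioi_deriv_of_nonneg' hg hpos hL)
  have hval : ∫ r in Set.Ioi (0 : ℝ), r ^ (d - 1) • G r = L := by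
    have hE : Set.EqOn (fun r : ℝ => r ^ (d - 1) • G r) g' (Set.Ioi 0) := hg'
    rw [setIntegral_congr_fun measurableSet_Ioi hE,
      integral_Ioi_of_hasDerivAt_of_nonneg' hg hpos hL, hg0, sub_zero]
  have hint : Integrable fun ξ : EuclideanSpace ℝ (Fin d) => G ‖ξ‖ := by
    rw [integrable_fun_norm_addHaar volume (f := G), finrank_euclideanSpace_fin]
    exact hint1
  have hI := integral_fun_norm_addHaar (volume : Measure (EuclideanSpace ℝ (Fin d))) G
  rw [finrank_euclideanSpace_fin, hval, measureReal_def, EuclideanSpace.volume_ball,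
    ENNReal.ofReal_one, one_pow, one_mul, Fintype.card_fin, ENNReal.toReal_ofReal
      (div_nonneg (by positivity) (Real.Gamma_pos_of_pos (by positivity)).le), nsmul_eq_mul,
    smul_eq_mul] at hI
  rw [← hI, ofReal_integral_eq_lintegral_ofReal hint
    (Filter.Eventually.of_forall fun ξ => hGp _ (norm_nonneg _))]
  refine lintegral_mono_ae ?_
  -- The origin must be excluded: for `k > 0` the minorant vanishes there, and its real inverse is
  -- `0` by convention.
  filter_upwards [Measure.ae_ne volume (0 : EuclideanSpace ℝ (Fin d))] with ξ hξ
  have hξ' : 0 < ‖ξ‖ := norm_pos_iff.mpr hξ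
  rw [ENNReal.ofReal_inv_of_pos (by positivity), ENNReal.inv_le_inv]
  exact ofReal_le_sobolevWeight hkl hl ξ

/-- The degrees `a - 1` and `a + 1` lie symmetrically about `d/2 = a`, so the radial integrand is a
multiple of `r/(1 + (κr²)²)`, with primitive a multiple of `arctan(κr²)`. -/
theorem lintegral_inv_sobolevWeight_even {a s : ℕ} (ha : 0 < a) (hs : a + 1 ≤ s) :
    ∫⁻ ξ, (sobolevWeight (2 * a) s ξ)⁻¹ ≤
      ENNReal.ofReal (Real.pi / 2 * √(a * (a + 1)) * (1 / (2 * √Real.pi)) ^ (2 * a)) := by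
  obtain ⟨b, rfl⟩ : ∃ b, a = b + 1 := ⟨a - 1, by omega⟩
  have hpi := Real.pi_pos
  -- `w²` is the quotient of factorials `l!/k!`; then `(κr²)²` is the quotient of the two terms of
  -- the minorant.
  set w : ℝ := √(((b + 1 : ℕ) : ℝ) * (((b + 1 : ℕ) : ℝ) + 1)) with hw
  have hw0 : 0 < w := by positivity
  have hw2 : w ^ 2 = ((b : ℝ) + 1) * ((b : ℝ) + 2) := by
    rw [hw, Real.sq_sqrt (by positivity)]; push_cast; ring
  set κ : ℝ := (2 * Real.pi) ^ 2 / w with hκ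
  have hκ0 : 0 < κ := by positivity
  set A : ℝ := (b.factorial : ℝ) / (2 * Real.pi) ^ (2 * b) with hA
  have hfac : (((b + 2).factorial : ℕ) : ℝ) = w ^ 2 * (b.factorial : ℝ) := by
    rw [hw2, Nat.factorial_succ, Nat.factorial_succ]; push_cast; ring
  have hf0 : (0 : ℝ) < b.factorial := by positivity
  refine (lintegral_inv_sobolevWeight_le (k := b) (l := b + 2) (d := 2 * (b + 1)) (by omega)
    (by omega) (by omega) (g := fun r => A * (1 / (2 * κ) * Real.arctan (κ * r ^ 2)))
    (g' := fun r => A * (r / (1 + (κ * r ^ 2) ^ 2))) (L := A * (1 / (2 * κ) * (Real.pi / 2)))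
    ?_ ?_ ?_ ?_).trans (ENNReal.ofReal_le_ofReal (le_of_eq ?_))
  · intro r _
    have h1 : HasDerivAt (fun r : ℝ => κ * r ^ 2) (κ * (2 * r)) r := by
      simpa using (hasDerivAt_pow 2 r).const_mul κ
    refine ((h1.arctan.const_mul (1 / (2 * κ))).const_mul A).congr_deriv ?_
    field_simp
  · simp
  · refine Filter.Tendsto.const_mul _ (Filter.Tendsto.const_mul _ ?_)
    refine (Real.tendsto_arctan_atTop.mono_right nhdsWithin_le_nhds).comp ?_
    exact (Filter.tendsto_pow_atTop (by norm_num)).const_mul_atTop hκ0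
  · intro r hr
    have hr' : 0 < r := hr
    rw [hfac, hA, hκ, show 2 * (b + 1) - 1 = 2 * b + 1 by omega, show 2 * (b + 2) = 2 * b + 4 by ring]
    simp only [pow_add, mul_pow, div_pow]
    field_simp
  · have hG : Real.Gamma (((2 * (b + 1) : ℕ) : ℝ) / 2 + 1) = ((b : ℝ) + 1) * (b.factorial : ℝ) := by
      have : ((2 * (b + 1) : ℕ) : ℝ) / 2 = ((b + 1 : ℕ) : ℝ) := by push_cast; ring
      rw [this, Real.Gamma_nat_eq_factorial, Nat.factorial_succ]
      push_cast
      ring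
    have hsq : √Real.pi ^ 2 = Real.pi := Real.sq_sqrt hpi.le
    have e1 : (1 / (2 * √Real.pi)) ^ (2 * (b + 1)) = 1 / ((4 * Real.pi) ^ b * (4 * Real.pi)) := by
      rw [pow_mul, div_pow, mul_pow, hsq, ← pow_succ, div_pow]
      norm_num
    have e2 : (2 * Real.pi) ^ (2 * b) = (4 * Real.pi) ^ b * Real.pi ^ b := by
      rw [pow_mul, ← mul_pow]
      congr 1
      ring
    rw [hG, hA, hκ, pow_mul √Real.pi, hsq, e1, e2, pow_succ]
    push_cast
    field_simp
    ring

/-- Here the degrees are `m` and `m + 1`, and `r^{2m}` cancels against the lower term, leaving a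
multiple of `1/(1 + (κr)²)`. -/
theorem lintegral_inv_sobolevWeight_odd {m s : ℕ} (hs : m + 1 ≤ s) :
    ∫⁻ ξ, (sobolevWeight (2 * m + 1) s ξ)⁻¹ ≤
      ENNReal.ofReal (Real.pi * √(m + 1) * (m.factorial / Real.Gamma (m + 1 / 2)) *
        (1 / (2 * √Real.pi)) ^ (2 * m + 1)) := by
  have hpi := Real.pi_pos
  set w : ℝ := √((m : ℝ) + 1) with hw
  have hw0 : 0 < w := by positivity
  have hw2 : w ^ 2 = (m : ℝ) + 1 := by
    rw [hw, Real.sq_sqrt (by positivity)]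
  set κ : ℝ := (2 * Real.pi) / w with hκ
  have hκ0 : 0 < κ := by positivity
  set A : ℝ := (m.factorial : ℝ) / (2 * Real.pi) ^ (2 * m) with hA
  have hfac : (((m + 1).factorial : ℕ) : ℝ) = w ^ 2 * (m.factorial : ℝ) := by
    rw [hw2, Nat.factorial_succ]; push_cast; ring
  have hf0 : (0 : ℝ) < m.factorial := by positivity
  refine (lintegral_inv_sobolevWeight_le (k := m) (l := m + 1) (d := 2 * m + 1) (by omega)
    (by omega) (by omega) (g := fun r => A * (1 / κ * Real.arctan (κ * r)))
    (g' := fun r => A * (1 / (1 + (κ * r) ^ 2))) (L := A * (1 / κ * (Real.pi / 2)))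
    ?_ ?_ ?_ ?_).trans (ENNReal.ofReal_le_ofReal (le_of_eq ?_))
  · intro r _
    have h1 : HasDerivAt (fun r : ℝ => κ * r) κ r := by
      simpa using (hasDerivAt_id r).const_mul κ
    refine ((h1.arctan.const_mul (1 / κ)).const_mul A).congr_deriv ?_
    field_simp
  · simp
  · refine Filter.Tendsto.const_mul _ (Filter.Tendsto.const_mul _ ?_)
    refine (Real.tendsto_arctan_atTop.mono_right nhdsWithin_le_nhds).comp ?_
    exact Filter.tendsto_id.const_mul_atTop hκ0
  · intro r hr
    have hr' : 0 < r := hr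
    rw [hfac, hA, hκ, show 2 * m + 1 - 1 = 2 * m by omega, show 2 * (m + 1) = 2 * m + 2 by ring]
    simp only [pow_add, mul_pow, div_pow]
    field_simp
  · have hG0 : 0 < Real.Gamma ((m : ℝ) + 1 / 2) := Real.Gamma_pos_of_pos (by positivity)
    have hG : Real.Gamma (((2 * m + 1 : ℕ) : ℝ) / 2 + 1) =
        ((m : ℝ) + 1 / 2) * Real.Gamma ((m : ℝ) + 1 / 2) := by
      have : ((2 * m + 1 : ℕ) : ℝ) / 2 = (m : ℝ) + 1 / 2 := by push_cast; ring
      rw [this, Real.Gamma_add_one (by positivity)]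
    have hsp : 0 < √Real.pi := Real.sqrt_pos.mpr hpi
    have hsq : Real.pi = √Real.pi ^ 2 := (Real.sq_sqrt hpi.le).symm
    rw [hG, hA, hκ]
    have e1 : (1 / (2 * √Real.pi)) ^ (2 * m + 1) =
        √Real.pi ^ (2 * m + 1) / ((2 * Real.pi) ^ (2 * m) * (2 * Real.pi)) := by
      rw [← pow_succ, ← div_pow]
      congr 1
      field_simp
      exact hsq
    rw [e1]
    push_cast
    field_simp

/-- Log-convexity of `Γ` at `m + 1`, the midpoint of `m + 1/2` and `m + 3/2`, combined with `Γ(m +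
3/2) = (m + 1/2) Γ(m + 1/2)`. -/
theorem factorial_div_Gamma_le (m : ℕ) :
    (m.factorial : ℝ) / Real.Gamma (m + 1 / 2) ≤ √(m + 1 / 2) := by
  have hG0 : 0 < Real.Gamma ((m : ℝ) + 1 / 2) := Real.Gamma_pos_of_pos (by positivity)
  have h := Real.Gamma_mul_add_mul_le_rpow_Gamma_mul_rpow_Gamma (s := (m : ℝ) + 1 / 2)
    (t := (m : ℝ) + 1 / 2 + 1) (a := 1 / 2) (b := 1 / 2) (by positivity) (by positivity)
    (by norm_num) (by norm_num) (by norm_num)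
  rw [show (1 / 2 : ℝ) * ((m : ℝ) + 1 / 2) + 1 / 2 * ((m : ℝ) + 1 / 2 + 1) = (m : ℝ) + 1 by ring,
    Real.Gamma_nat_eq_factorial, Real.Gamma_add_one (by positivity), ← Real.sqrt_eq_rpow,
    ← Real.sqrt_eq_rpow, Real.sqrt_mul (by positivity), mul_left_comm,
    Real.mul_self_sqrt hG0.le] at h
  rwa [div_le_iff₀ hG0]

theorem lintegral_inv_sobolevWeight_le_linear {d s : ℕ} (hd : 0 < d) (hs : d < 2 * s) :
    ∫⁻ ξ, (sobolevWeight d s ξ)⁻¹ ≤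
      ENNReal.ofReal (Real.pi / 2 * (d + 1) * (1 / (2 * √Real.pi)) ^ d) := by
  have hpi := Real.pi_pos
  rcases Nat.even_or_odd' d with ⟨a, rfl | rfl⟩
  · refine (lintegral_inv_sobolevWeight_even (by omega) (by omega)).trans
      (ENNReal.ofReal_le_ofReal ?_)
    gcongr
    refine Real.sqrt_le_iff.mpr ⟨by positivity, ?_⟩
    push_cast
    nlinarith [(Nat.cast_nonneg a : (0 : ℝ) ≤ a)]
  · refine (lintegral_inv_sobolevWeight_odd (by omega)).trans (ENNReal.ofReal_le_ofReal ?_)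
    refine mul_le_mul_of_nonneg_right ?_ (by positivity)
    have h1 := factorial_div_Gamma_le a
    have h2 : √((a : ℝ) + 1 / 2) ≤ √((a : ℝ) + 1) := Real.sqrt_le_sqrt (by linarith)
    calc Real.pi * √((a : ℝ) + 1) * (a.factorial / Real.Gamma (a + 1 / 2))
        ≤ Real.pi * √((a : ℝ) + 1) * √((a : ℝ) + 1) := by gcongr; exact h1.trans h2
      _ = Real.pi / 2 * (((2 * a + 1 : ℕ) : ℝ) + 1) := by
          rw [mul_assoc, Real.mul_self_sqrt (by positivity)]
          push_cast
          ring

theorem lintegral_inv_sobolevWeight_le_quadratic {d s : ℕ} (hd : 0 < d) (hs : d < 2 * s) :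
    ∫⁻ ξ, (sobolevWeight d s ξ)⁻¹ ≤
      ENNReal.ofReal ((d + 1) ^ 2 / 2 * (1 / (2 * √Real.pi)) ^ d) := by
  have hpi := Real.pi_pos
  have hpi' := Real.pi_lt_d2
  -- From `d = 3` on, `π ≤ d + 1` makes the linear bound sufficient. For `d = 1, 2` the unsimplified
  -- integrals are used, and they reduce to `√π ≤ 2` and `π ≤ 9/2`.
  rcases (by omega : d = 1 ∨ d = 2 ∨ 3 ≤ d) with rfl | rfl | h3
  · refine (lintegral_inv_sobolevWeight_odd (m := 0) (by omega)).trans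
      (ENNReal.ofReal_le_ofReal ?_)
    refine mul_le_mul_of_nonneg_right ?_ (by positivity)
    have hsp : 0 < √Real.pi := Real.sqrt_pos.mpr hpi
    have hsq : √Real.pi * √Real.pi = Real.pi := Real.mul_self_sqrt hpi.le
    have h2 : √Real.pi ≤ 2 := Real.sqrt_le_iff.mpr ⟨by norm_num, by linarith⟩
    rw [Nat.cast_zero, zero_add, zero_add, Real.Gamma_one_half_eq, Real.sqrt_one, mul_one,
      Nat.factorial_zero, Nat.cast_one, mul_one_div, Real.div_sqrt]
    norm_num
    exact h2
  · refine (lintegral_inv_sobolevWeight_even (a := 1) (by omega) (by omega)).trans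
      (ENNReal.ofReal_le_ofReal ?_)
    refine mul_le_mul_of_nonneg_right ?_ (by positivity)
    have h2 : √((1 : ℕ) * ((1 : ℕ) + 1) : ℝ) ≤ 2 :=
      Real.sqrt_le_iff.mpr ⟨by norm_num, by norm_num⟩
    calc Real.pi / 2 * √((1 : ℕ) * ((1 : ℕ) + 1) : ℝ) ≤ Real.pi / 2 * 2 := by gcongr
      _ ≤ _ := by norm_num; linarith
  · refine (lintegral_inv_sobolevWeight_le_linear hd hs).trans (ENNReal.ofReal_le_ofReal ?_)
    refine mul_le_mul_of_nonneg_right ?_ (by positivity)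
    have h3' : (3 : ℝ) ≤ d := by exact_mod_cast h3
    nlinarith

/-! ### Numerical comparison with `(6/11)^d` -/

theorem embedding_bound_eq_sqrt (d : ℕ) :
    ((d : ℝ) + 1) / ((2 : ℝ) ^ (((d : ℝ) + 1) / 2) * Real.pi ^ ((d : ℝ) / 4)) =
      √(((d : ℝ) + 1) ^ 2 / 2 * (1 / (2 * √Real.pi)) ^ d) := by
  have hpi := Real.pi_pos
  have e1 : ((2 : ℝ) ^ (((d : ℝ) + 1) / 2)) ^ 2 = 2 ^ (d + 1) := by
    rw [← Real.rpow_natCast, ← Real.rpow_mul (by norm_num), ← Real.rpow_natCast]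
    congr 1
    push_cast
    ring
  have e2 : (Real.pi ^ ((d : ℝ) / 4)) ^ 2 = √Real.pi ^ d := by
    rw [Real.sqrt_eq_rpow, ← Real.rpow_natCast, ← Real.rpow_natCast, ← Real.rpow_mul hpi.le,
      ← Real.rpow_mul hpi.le]
    congr 1
    push_cast
    ring
  have e3 : (((d : ℝ) + 1) / ((2 : ℝ) ^ (((d : ℝ) + 1) / 2) * Real.pi ^ ((d : ℝ) / 4))) ^ 2 =
      ((d : ℝ) + 1) ^ 2 / 2 * (1 / (2 * √Real.pi)) ^ d := by
    rw [div_pow, mul_pow, e1, e2, one_div_pow, mul_pow, pow_succ (2 : ℝ)]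
    field_simp
  rw [← e3, Real.sqrt_sq (by positivity)]

/-- The ratio of consecutive terms of `(d+1)² · 0.948155^d` is at least 1 in this range. The
sequence peaks at `d = 37`, with `d = 36` next, and decreases afterwards. -/
theorem sq_mul_pow_le_of_le {d n : ℕ} (h : d ≤ n) (hn : n ≤ 35) :
    ((d : ℝ) + 1) ^ 2 * 0.948155 ^ d ≤ ((n : ℝ) + 1) ^ 2 * 0.948155 ^ n := by
  induction n, h using Nat.le_induction with
  | base => exact le_rfl
  | succ n h ih =>
    refine (ih (by omega)).trans ?_
    have h0 : (0 : ℝ) ≤ n := Nat.cast_nonneg n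
    have h34 : (n : ℝ) ≤ 34 := by exact_mod_cast (by omega : n ≤ 34)
    have h1 : ((n : ℝ) + 1) ^ 2 ≤ (((n + 1 : ℕ) : ℝ) + 1) ^ 2 * 0.948155 := by
      push_cast
      nlinarith [mul_nonneg h0 (sub_nonneg.mpr h34)]
    calc _ ≤ ((((n + 1 : ℕ) : ℝ) + 1) ^ 2 * 0.948155) * 0.948155 ^ n := by gcongr
      _ = _ := by rw [pow_succ]; ring

theorem sq_mul_pow_le_of_ge {d : ℕ} (h : 38 ≤ d) :
    ((d : ℝ) + 1) ^ 2 * 0.948155 ^ d ≤ 39 ^ 2 * 0.948155 ^ 38 := by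
  induction d, h using Nat.le_induction with
  | base => norm_num
  | succ n h ih =>
    refine le_trans ?_ ih
    have h0 : (38 : ℝ) ≤ n := by exact_mod_cast h
    have h1 : (((n + 1 : ℕ) : ℝ) + 1) ^ 2 * 0.948155 ≤ ((n : ℝ) + 1) ^ 2 := by
      push_cast
      nlinarith [mul_nonneg (sub_nonneg.mpr h0) (sub_nonneg.mpr h0)]
    calc _ = ((((n + 1 : ℕ) : ℝ) + 1) ^ 2 * 0.948155) * 0.948155 ^ n := by rw [pow_succ]; ring
      _ ≤ _ := by gcongr

theorem quadratic_mul_pow_le {d : ℕ} {C : ℝ}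
    (h : ((d : ℝ) + 1) ^ 2 * 0.948155 ^ d ≤ 2 * C ^ 2) :
    ((d : ℝ) + 1) ^ 2 / 2 * (1 / (2 * √Real.pi)) ^ d ≤ (C * (6 / 11) ^ d) ^ 2 := by
  have hsp : 0 < √Real.pi := Real.sqrt_pos.mpr Real.pi_pos
  -- `0.948155` is a rational slightly above `121/(72√π)`, the ratio of `1/(2√π)` to `(6/11)²`.
  have hq : 1 / (2 * √Real.pi) ≤ 0.948155 * (36 / 121) := by
    have h1 : 1.77245 ≤ √Real.pi := by
      refine Real.le_sqrt_of_sq_le ?_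
      have := Real.pi_gt_d6
      norm_num at this ⊢
      linarith
    rw [div_le_iff₀ (by positivity)]
    nlinarith
  calc ((d : ℝ) + 1) ^ 2 / 2 * (1 / (2 * √Real.pi)) ^ d
      ≤ ((d : ℝ) + 1) ^ 2 / 2 * (0.948155 * (36 / 121)) ^ d := by gcongr
    _ = (((d : ℝ) + 1) ^ 2 * 0.948155 ^ d) / 2 * (36 / 121) ^ d := by rw [mul_pow]; ring
    _ ≤ 2 * C ^ 2 / 2 * (36 / 121) ^ d := by gcongr
    _ = (C * (6 / 11) ^ d) ^ 2 := by
      rw [mul_pow, ← pow_mul, mul_comm d 2, pow_mul]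
      norm_num

theorem quadratic_mul_pow_le_of_ne {d : ℕ} (h36 : d ≠ 36) (h37 : d ≠ 37) :
    ((d : ℝ) + 1) ^ 2 / 2 * (1 / (2 * √Real.pi)) ^ d ≤ (10.03 * (6 / 11) ^ d) ^ 2 := by
  refine quadratic_mul_pow_le ?_
  rcases (by omega : d ≤ 35 ∨ 38 ≤ d) with h | h
  · refine (sq_mul_pow_le_of_le h le_rfl).trans ?_
    norm_num
  · refine (sq_mul_pow_le_of_ge h).trans ?_
    norm_num

theorem quadratic_mul_pow_le_of_all (d : ℕ) :
    ((d : ℝ) + 1) ^ 2 / 2 * (1 / (2 * √Real.pi)) ^ d ≤ (10.04 * (6 / 11) ^ d) ^ 2 := by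
  by_cases h36 : d = 36
  · subst h36
    refine quadratic_mul_pow_le ?_
    norm_num
  by_cases h37 : d = 37
  · subst h37
    refine quadratic_mul_pow_le ?_
    norm_num
  refine (quadratic_mul_pow_le_of_ne h36 h37).trans ?_
  gcongr
  norm_num

theorem norm_isLinftyEmbedding_le {d s : ℕ} (hd : 0 < d) (hs : d < 2 * s)
    {I : SobolevSpace d s →L[ℂ] LinftySpace d} (hI : IsLinftyEmbedding I) :
    ‖I‖ ≤ √(((d : ℝ) + 1) ^ 2 / 2 * (1 / (2 * √Real.pi)) ^ d) ∧
      ‖I‖ ≤ 10.03 * ((6 : ℝ) / 11) ^ d := by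
  have hpi := Real.pi_pos
  have hQ := lintegral_inv_sobolevWeight_le_quadratic hd hs
  have h1 : ‖I‖ ≤ √(((d : ℝ) + 1) ^ 2 / 2 * (1 / (2 * √Real.pi)) ^ d) := by
    rw [hI.norm_eq (hQ.trans_lt ENNReal.ofReal_lt_top).ne]
    exact Real.sqrt_le_sqrt (ENNReal.toReal_le_of_le_ofReal (by positivity) hQ)
  refine ⟨h1, ?_⟩
  -- In the two exceptional dimensions the linear bound wins a factor 2 over the quadratic one,
  -- since `2π ≤ d + 1`; then `10.04²/2 ≤ 10.03²` suffices.
  by_cases hcase : d = 36 ∨ d = 37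
  · have hd36 : (36 : ℝ) ≤ d := by
      exact_mod_cast (by omega : 36 ≤ d)
    have hlin := lintegral_inv_sobolevWeight_le_linear hd hs
    rw [hI.norm_eq (hQ.trans_lt ENNReal.ofReal_lt_top).ne]
    refine Real.sqrt_le_iff.mpr ⟨by positivity, ?_⟩
    refine (ENNReal.toReal_le_of_le_ofReal (by positivity) hlin).trans ?_
    have hq : (0 : ℝ) ≤ (1 / (2 * √Real.pi)) ^ d := by positivity
    have h2 : Real.pi / 2 * ((d : ℝ) + 1) ≤ 1 / 2 * (((d : ℝ) + 1) ^ 2 / 2) := by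
      have := Real.pi_lt_d2
      nlinarith
    calc _ ≤ 1 / 2 * (((d : ℝ) + 1) ^ 2 / 2) * (1 / (2 * √Real.pi)) ^ d :=
          mul_le_mul_of_nonneg_right h2 hq
      _ ≤ 1 / 2 * (10.04 * (6 / 11) ^ d) ^ 2 := by
          rw [mul_assoc]
          exact mul_le_mul_of_nonneg_left (quadratic_mul_pow_le_of_all d) (by norm_num)
      _ ≤ _ := by
          rw [mul_pow, mul_pow, ← mul_assoc]
          gcongr
          norm_num
  · refine h1.trans (Real.sqrt_le_iff.mpr ⟨by positivity, ?_⟩)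
    exact quadratic_mul_pow_le_of_ne (fun h => hcase (Or.inl h)) (fun h => hcase (Or.inr h))

/-- After taking the `d`-th root and squaring, this is `25/121 ≤ 2/(3π)`, that is `π ≤ 242/75`. -/
theorem pow_five_elevenths_le (d : ℕ) :
    ((5 : ℝ) / 11) ^ d ≤ (2 / (3 * Real.pi)) ^ ((d : ℝ) / 2) := by
  have hpi := Real.pi_pos
  have e : (2 / (3 * Real.pi)) ^ ((d : ℝ) / 2) = √(2 / (3 * Real.pi)) ^ d := by
    rw [Real.sqrt_eq_rpow, ← Real.rpow_natCast, ← Real.rpow_mul (by positivity)]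
    congr 1
    ring
  rw [e]
  gcongr
  refine Real.le_sqrt_of_sq_le ?_
  rw [le_div_iff₀ (by positivity)]
  have := Real.pi_lt_d2
  linarith

theorem mainTheorem3 (d s : ℕ) (hd : 0 < d) (hs : (d : ℝ) / 2 < (s : ℝ)) :
    ∃ (Iinf : SobolevSpace d ⊤ →L[ℂ] LinftySpace d)
      (I : SobolevSpace d (s : ℕ∞) →L[ℂ] LinftySpace d),
      IsLinftyEmbedding Iinf ∧ IsLinftyEmbedding I ∧
      ((5 : ℝ) / 11) ^ d ≤ (2 / (3 * Real.pi)) ^ ((d : ℝ) / 2) ∧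
      (2 / (3 * Real.pi)) ^ ((d : ℝ) / 2) = ‖Iinf‖ ∧
      ‖Iinf‖ ≤ ‖I‖ ∧
      ‖I‖ ≤ ((d : ℝ) + 1) /
        ((2 : ℝ) ^ (((d : ℝ) + 1) / 2) * Real.pi ^ ((d : ℝ) / 4)) ∧
      ‖I‖ ≤ 10.03 * ((6 : ℝ) / 11) ^ d ∧
      (d ≠ 36 → d ≠ 37 →
        ((d : ℝ) + 1) / ((2 : ℝ) ^ (((d : ℝ) + 1) / 2) * Real.pi ^ ((d : ℝ) / 4)) ≤
          10.03 * ((6 : ℝ) / 11) ^ d) ∧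
      ((d : ℝ) + 1) / ((2 : ℝ) ^ (((d : ℝ) + 1) / 2) * Real.pi ^ ((d : ℝ) / 4)) ≤
        10.04 * ((6 : ℝ) / 11) ^ d := by
  have hpi := Real.pi_pos
  have hs' : d < 2 * s := by
    have : (d : ℝ) < 2 * s := by linarith
    exact_mod_cast this
  have hKtop : ∫⁻ ξ, (sobolevWeight d ⊤ ξ)⁻¹ ≠ ⊤ := by
    rw [lintegral_inv_sobolevWeight_top]
    exact ENNReal.ofReal_ne_top
  have hK : ∫⁻ ξ, (sobolevWeight d s ξ)⁻¹ ≠ ⊤ :=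
    ((lintegral_inv_sobolevWeight_le_quadratic hd hs').trans_lt ENNReal.ofReal_lt_top).ne
  obtain ⟨Iinf, hIinf, -⟩ := exists_isLinftyEmbedding hKtop
  obtain ⟨I, hI, -⟩ := exists_isLinftyEmbedding hK
  obtain ⟨hB, h10⟩ := norm_isLinftyEmbedding_le hd hs' hI
  rw [embedding_bound_eq_sqrt]
  refine ⟨Iinf, I, hIinf, hI, pow_five_elevenths_le d, ?_, IsLinftyEmbedding.norm_le le_top hI hIinf,
    hB, h10, fun h36 h37 => ?_, ?_⟩
  · rw [hIinf.norm_eq hKtop, lintegral_inv_sobolevWeight_top,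
      ENNReal.toReal_ofReal (by positivity), Real.sqrt_eq_rpow, ← Real.rpow_natCast,
      ← Real.rpow_mul (by positivity)]
    congr 1
    ring
  · exact Real.sqrt_le_iff.mpr ⟨by positivity, quadratic_mul_pow_le_of_ne h36 h37⟩
  · exact Real.sqrt_le_iff.mpr ⟨by positivity, quadratic_mul_pow_le_of_all d⟩
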